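/- Let $\{0,1\}^{\mathbb N}$ be the Cantor space with the product topology; for a finite binary word $w$ let $[w]$ be the cylinder of all sequences with prefix $w$. A map $f:\{0,1\}^{\mathbb N}\to\{0,1\}^{\mathbb N}$ is \emph{computable} if there is an algorithm which, given a finite word $v$, enumerates a set $I_v$ of finite words such that $f^{-1}([v])=\bigcup_{u\in I_v}[u]$. The topological entropy of such a map is $$h(f)=\sup_{\mathcal U}\ \inf_{n\ge 1}\frac{\log_2 N_n(f,\mathcal U)}{n}\in[0,+\infty],$$ where $\mathcal U$ ranges over the finite open covers of $\{0,1\}^{\mathbb N}$ and $N_n(f,\mathcal U)$ is the minimal cardinality of a sub-cover of $\bigvee_{0\le k\le n-1}f^{-k}(\mathcal U)$. A real number $x$ is \emph{$\Sigma_2$-computable} if there is an algorithm computing a double sequence $(q_{ij})_{i,j\in\mathbb N}$ of rationals such that each $\inf_j q_{ij}$ is a real number and $x=\sup_i\inf_j q_{ij}$. \textbf{Theorem.} A non-negative real number is the topological entropy of a computable surjective map $f:\{0,1\}^{\mathbb N}\to\{0,1\}^{\mathbb N}$ if and only if it is $\Sigma_2$-computable. -/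

import Mathlib

/-- The double sequence `q` of rationals is computable: an algorithm outputs, on input `(i, j)`,
a numerator and a nonzero denominator of `q i j`. -/
def IsComputableRatDoubleSeq (q : ℕ → ℕ → ℚ) : Prop :=
  ∃ (a : ℕ → ℕ → ℤ) (b : ℕ → ℕ → ℕ), Computable₂ a ∧ Computable₂ b ∧
    ∀ i j, b i j ≠ 0 ∧ q i j = (a i j : ℚ) / (b i j : ℚ)

/-- The real number `x` is `Σ₂`-computable: `x = sup_i inf_j q i j` for some computable double
sequence `q` of rationals (where `y i` is the infimum of the `i`-th row, a real number). -/
def IsSigmaTwoComputable (x : ℝ) : Prop :=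
  ∃ q : ℕ → ℕ → ℚ, IsComputableRatDoubleSeq q ∧
    ∃ y : ℕ → ℝ, (∀ i, IsGLB (Set.range fun j => (q i j : ℝ)) (y i)) ∧ IsLUB (Set.range y) x

/-- The cylinder of all infinite binary sequences with prefix `w`. The cylinders are the
ideal balls of the Cantor space. -/
def binaryCylinder (w : List Bool) : Set (ℕ → Bool) :=
  {x | ∀ (i : ℕ) (hi : i < w.length), x i = w[i]}

/-- A map of the Cantor space `{0,1}^ℕ` is computable: an algorithm, given (the index of) an ideal
ball `binaryCylinder v`, enumerates a set of ideal balls whose union is the preimage of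
`binaryCylinder v`. -/
def IsComputableCantorMap (f : (ℕ → Bool) → (ℕ → Bool)) : Prop :=
  ∃ R : List Bool → List Bool → Prop,
    REPred (fun p : List Bool × List Bool => R p.1 p.2) ∧
      ∀ v : List Bool, f ⁻¹' binaryCylinder v = ⋃ u ∈ {u : List Bool | R v u}, binaryCylinder u

/-- The join of the families `f^{-k}(𝒰)` for `k = 0, …, n - 1`. -/
def dynamicalJoin {X : Type*} (f : X → X) (𝒰 : Set (Set X)) (n : ℕ) : Set (Set X) :=
  {V | ∃ U : Fin n → Set X, (∀ k, U k ∈ 𝒰) ∧ V = ⋂ k : Fin n, f^[(k : ℕ)] ⁻¹' U k}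

/-- The minimal cardinality of a (finite) sub-cover of the join of the families `f^{-k}(𝒰)`,
`k < n`. -/
noncomputable def minSubcoverCard {X : Type*} (f : X → X) (𝒰 : Set (Set X)) (n : ℕ) : ℕ :=
  sInf {m | ∃ s : Finset (Set X),
    (s : Set (Set X)) ⊆ dynamicalJoin f 𝒰 n ∧ ⋃₀ (s : Set (Set X)) = Set.univ ∧ s.card = m}

/-- The entropy of `f` relative to the cover `𝒰`, with logarithms in base two; the infimum is over
the positive integers `n + 1`. -/
noncomputable def entropyRelCover {X : Type*} (f : X → X) (𝒰 : Set (Set X)) : ℝ :=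
  ⨅ n : ℕ, Real.logb 2 (minSubcoverCard f 𝒰 (n + 1) : ℝ) / ((n : ℝ) + 1)

/-- The topological entropy of `f : X → X`: the supremum, possibly infinite, of the entropies
relative to the finite open covers of `X`. -/
noncomputable def topologicalEntropy {X : Type*} [TopologicalSpace X] (f : X → X) : EReal :=
  ⨆ 𝒰 ∈ {𝒰 : Set (Set X) | 𝒰.Finite ∧ (∀ U ∈ 𝒰, IsOpen U) ∧ ⋃₀ 𝒰 = Set.univ},
    (entropyRelCover f 𝒰 : EReal)

/-! By compactness every open cover is refined by a partition into cylinders of some length `n`, so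
the entropy is the supremum over `n` of the entropies relative to these partitions. Relative to a
partition, a minimal sub-cover counts itineraries.

Entropies are Σ₂. An upper bound on the number of itineraries has a finite witness: for every word
of length `l`, a chain of words whose cylinders are shown, by finitely many enumerated facts, to be
mapped into one another. Validity of such a certificate is decidable. Valid certificates give true
bounds (`entropyRelCover_le_of_isValid`) and, by compactness, every true bound has one
(`exists_isValid`). Hence the entropy at precision `n` is an infimum of rationals computable
uniformly in `n`.

Σ₂ numbers are entropies. Let `i` run through the codes of all triples of a row `s`, a numerator `a
≥ 1` and an exponent `m`. On the sequences `1ⁱ 0 z` run an `m`-bit counter and, at each overflow,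
shift the remaining bits by `a`; this reveals `a` new bits every `2 ^ m` steps, a rate of `a / 2 ^
m`. The piece should contribute only if `a / 2 ^ m ≤ inf_j q s j`, a condition that can be refuted
but not decided. So the shift is arranged (`truncatedShift`) that a refutation at index `T` turns it
into a permutation of finitely many coordinates, which creates no entropy, while its value at `n`
consults only the tests up to `n`. The map is then computable, and surjective because the coordinate
maps are injective. Its entropy is the supremum of 0 and the surviving rates, which is `h`.

Both rate estimates follow the quantity `2 ^ m * l - a * c`, where `c` is the counter value and `m +
l` the length of an agreeing prefix: it drops by at most `a` per step
(`exists_counterSkew_mem_cylinder`) and can be recovered backwards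
(`exists_mem_cylinder_of_counterSkew`). -/

open PiNat Function

/-! ### Cylinder partitions and compactness -/

/-- The partition of the Cantor space into the cylinders of length `n`. -/
def cylinderPartition (n : ℕ) : Set (Set (ℕ → Bool)) :=
  Set.range fun x : ℕ → Bool => cylinder x n

theorem cylinder_eq_of_mem {x y : ℕ → Bool} {n : ℕ} (h : y ∈ cylinder x n) :
    cylinder y n = cylinder x n :=
  mem_cylinder_iff_eq.1 h

/-- The point `w 0 0 0 …`. -/
def padFalse {n : ℕ} (w : Fin n → Bool) : ℕ → Bool := fun i => if h : i < n then w ⟨i, h⟩ else false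

theorem mem_cylinder_padFalse (x : ℕ → Bool) (n : ℕ) :
    x ∈ cylinder (padFalse fun i : Fin n => x i) n := by
  intro i hi
  simp [padFalse, hi]

theorem finite_cylinderPartition (n : ℕ) : (cylinderPartition n).Finite := by
  refine (Set.finite_range fun w : Fin n → Bool => cylinder (padFalse w) n).subset ?_
  rintro _ ⟨x, rfl⟩
  exact ⟨fun i => x i, (cylinder_eq_of_mem (mem_cylinder_padFalse x n)).symm⟩

theorem isOpen_of_mem_cylinderPartition {n : ℕ} {U : Set (ℕ → Bool)}
    (hU : U ∈ cylinderPartition n) : IsOpen U := by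
  obtain ⟨x, rfl⟩ := hU
  exact isOpen_cylinder _ x n

theorem sUnion_cylinderPartition (n : ℕ) : ⋃₀ cylinderPartition n = Set.univ :=
  Set.eq_univ_of_forall fun x => ⟨_, ⟨x, rfl⟩, self_mem_cylinder x n⟩

/-- A form of the fan theorem: a property that eventually holds, locally uniformly, holds at
a uniform level. -/
theorem exists_uniform_level {Q : (ℕ → Bool) → ℕ → Prop}
    (h : ∀ x, ∃ l, ∀ y ∈ cylinder x l, ∀ m ≥ l, Q y m) : ∃ l, ∀ m ≥ l, ∀ x, Q x m := by
  have key : ∃ l, ∀ m ≥ l, ∀ x ∈ (Set.univ : Set (ℕ → Bool)), Q x m := by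
    refine isCompact_univ.induction_on (p := fun s => ∃ l, ∀ m ≥ l, ∀ x ∈ s, Q x m) ?_ ?_ ?_ ?_
    · exact ⟨0, by simp⟩
    · rintro s t hst ⟨l, hl⟩
      exact ⟨l, fun m hm x hx => hl m hm x (hst hx)⟩
    · rintro s t ⟨l, hl⟩ ⟨l', hl'⟩
      refine ⟨max l l', fun m hm x hx => ?_⟩
      rcases hx with hx | hx
      · exact hl m (le_trans (le_max_left _ _) hm) x hx
      · exact hl' m (le_trans (le_max_right _ _) hm) x hx
    · intro x _
      obtain ⟨l, hl⟩ := h x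
      refine ⟨cylinder x l, ?_, l, fun m hm y hy => hl y hy m hm⟩
      exact mem_nhdsWithin_of_mem_nhds ((isOpen_cylinder _ x l).mem_nhds (self_mem_cylinder x l))
  obtain ⟨l, hl⟩ := key
  exact ⟨l, fun m hm x => hl m hm x trivial⟩

theorem exists_cylinder_subset {U : Set (ℕ → Bool)} (hU : IsOpen U) {x : ℕ → Bool} (hx : x ∈ U) :
    ∃ n, cylinder x n ⊆ U := by
  obtain ⟨v, ⟨y, n, rfl⟩, hxv, hv⟩ :=
    (isTopologicalBasis_cylinders fun _ : ℕ => Bool).exists_subset_of_mem_open hx hU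
  exact ⟨n, (cylinder_eq_of_mem hxv).trans_subset hv⟩

/-- Every open cover is refined by a cylinder partition. -/
theorem exists_cylinder_refinement {𝒰 : Set (Set (ℕ → Bool))} (ho : ∀ U ∈ 𝒰, IsOpen U)
    (hc : ⋃₀ 𝒰 = Set.univ) : ∃ n, ∀ x, ∃ U ∈ 𝒰, cylinder x n ⊆ U := by
  obtain ⟨l, hl⟩ := exists_uniform_level (Q := fun x n => ∃ U ∈ 𝒰, cylinder x n ⊆ U) (by
    intro x
    obtain ⟨U, hU, hxU⟩ : x ∈ ⋃₀ 𝒰 := hc ▸ trivial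
    obtain ⟨n, hn⟩ := exists_cylinder_subset (ho U hU) hxU
    refine ⟨n, fun y hy m hm => ⟨U, hU, ?_⟩⟩
    exact (cylinder_anti y hm).trans ((cylinder_eq_of_mem hy).trans_subset hn))
  exact ⟨l, hl l le_rfl⟩

/-! ### Sub-covers of joins and entropy relative to a cover -/

section Covers

variable {X : Type*} {f : X → X} {𝒰 : Set (Set X)}

theorem finite_dynamicalJoin (h : 𝒰.Finite) (k : ℕ) : (dynamicalJoin f 𝒰 k).Finite := by
  have : Finite 𝒰 := h
  refine (Set.finite_range fun U : Fin k → 𝒰 =>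
    ⋂ j : Fin k, f^[(j : ℕ)] ⁻¹' (U j : Set X)).subset ?_
  rintro V ⟨U, hU, rfl⟩
  exact ⟨fun j => ⟨U j, hU j⟩, rfl⟩

theorem sUnion_dynamicalJoin (h : ⋃₀ 𝒰 = Set.univ) (k : ℕ) :
    ⋃₀ dynamicalJoin f 𝒰 k = Set.univ := by
  refine Set.eq_univ_of_forall fun x => ?_
  have : ∀ j : Fin k, ∃ U ∈ 𝒰, f^[(j : ℕ)] x ∈ U := fun j => by
    obtain ⟨U, hU, hx⟩ : f^[(j : ℕ)] x ∈ ⋃₀ 𝒰 := h ▸ trivial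
    exact ⟨U, hU, hx⟩
  choose U hU hx using this
  exact ⟨_, ⟨U, hU, rfl⟩, Set.mem_iInter.2 hx⟩

theorem minSubcoverCard_le_card {s : Finset (Set X)} {k : ℕ}
    (hs : (s : Set (Set X)) ⊆ dynamicalJoin f 𝒰 k) (hc : ⋃₀ (s : Set (Set X)) = Set.univ) :
    minSubcoverCard f 𝒰 k ≤ s.card :=
  Nat.sInf_le ⟨s, hs, hc, rfl⟩

theorem exists_minimal_subcover (hf : 𝒰.Finite) (h : ⋃₀ 𝒰 = Set.univ) (k : ℕ) :
    ∃ s : Finset (Set X), (s : Set (Set X)) ⊆ dynamicalJoin f 𝒰 k ∧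
      ⋃₀ (s : Set (Set X)) = Set.univ ∧ s.card = minSubcoverCard f 𝒰 k := by
  have hne : {m | ∃ s : Finset (Set X), (s : Set (Set X)) ⊆ dynamicalJoin f 𝒰 k ∧
      ⋃₀ (s : Set (Set X)) = Set.univ ∧ s.card = m}.Nonempty :=
    ⟨_, (finite_dynamicalJoin (f := f) hf k).toFinset, by simp, by
      simpa using sUnion_dynamicalJoin h k, rfl⟩
  exact Nat.sInf_mem hne

/-- A finite cover refining the join bounds the minimal cardinality of a sub-cover. -/
theorem minSubcoverCard_le_of_refinement {ι : Type*} [Fintype ι] {k : ℕ} (V : ι → Set X)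
    (hV : ∀ x, ∃ i, x ∈ V i) (h : ∀ i, ∃ W ∈ dynamicalJoin f 𝒰 k, V i ⊆ W) :
    minSubcoverCard f 𝒰 k ≤ Fintype.card ι := by
  classical
  choose W hW hVW using h
  refine (minSubcoverCard_le_card (s := Finset.univ.image W) ?_ ?_).trans Finset.card_image_le
  · intro A hA
    obtain ⟨i, -, rfl⟩ := Finset.mem_image.1 hA
    exact hW i
  · refine Set.eq_univ_of_forall fun x => ?_
    obtain ⟨i, hi⟩ := hV x
    exact ⟨W i, by simp, hVW i hi⟩

theorem zero_le_logb_minSubcoverCard_div (k : ℕ) :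
    0 ≤ Real.logb 2 (minSubcoverCard f 𝒰 (k + 1) : ℝ) / ((k : ℝ) + 1) := by
  refine div_nonneg ?_ (by positivity)
  -- For the count 0 the convention `Real.logb 2 0 = 0` keeps the quotient nonnegative, so no
  -- assumption on the cover is needed.
  rcases Nat.eq_zero_or_pos (minSubcoverCard f 𝒰 (k + 1)) with h | h
  · simp [h]
  · exact Real.logb_nonneg (by norm_num) (by exact_mod_cast h)

theorem entropyRelCover_nonneg : 0 ≤ entropyRelCover f 𝒰 :=
  Real.iInf_nonneg zero_le_logb_minSubcoverCard_div

theorem entropyRelCover_le (k : ℕ) :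
    entropyRelCover f 𝒰 ≤ Real.logb 2 (minSubcoverCard f 𝒰 (k + 1) : ℝ) / ((k : ℝ) + 1) :=
  ciInf_le ⟨0, by rintro _ ⟨k, rfl⟩; exact zero_le_logb_minSubcoverCard_div k⟩ k

theorem minSubcoverCard_pos [Nonempty X] (hf : 𝒰.Finite) (h : ⋃₀ 𝒰 = Set.univ) (k : ℕ) :
    0 < minSubcoverCard f 𝒰 k := by
  obtain ⟨s, -, hc, hs⟩ := exists_minimal_subcover (f := f) hf h k
  rw [← hs, Finset.card_pos]
  obtain ⟨V, hV, -⟩ : Classical.arbitrary X ∈ ⋃₀ (s : Set (Set X)) := hc ▸ trivial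
  exact ⟨V, hV⟩

end Covers

/-! ### Counting itineraries -/

variable {f : (ℕ → Bool) → (ℕ → Bool)}

/-- If sets covering the space have constant itineraries at precision `n`, their number bounds the
minimal cardinality of a sub-cover, for every cover refined by the cylinders of length `n`. -/
theorem minSubcoverCard_le_of_itinerary {𝒰 : Set (Set (ℕ → Bool))} {n k : ℕ}
    (hn : ∀ x, ∃ U ∈ 𝒰, cylinder x n ⊆ U) {ι : Type*} [Fintype ι] (V : ι → Set (ℕ → Bool))
    (hV : ∀ x, ∃ i, x ∈ V i)
    (h : ∀ i, ∀ x ∈ V i, ∀ y ∈ V i, ∀ j < k, f^[j] y ∈ cylinder (f^[j] x) n) :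
    minSubcoverCard f 𝒰 k ≤ Fintype.card ι := by
  refine minSubcoverCard_le_of_refinement V hV fun i => ?_
  have key : ∃ x, ∀ y ∈ V i, ∀ j < k, f^[j] y ∈ cylinder (f^[j] x) n := by
    rcases (V i).eq_empty_or_nonempty with he | ⟨x, hx⟩
    · exact ⟨fun _ => false, by simp [he]⟩
    · exact ⟨x, h i x hx⟩
  obtain ⟨x, hx⟩ := key
  choose U hU hxU using fun j : Fin k => hn (f^[(j : ℕ)] x)
  exact ⟨_, ⟨U, hU, rfl⟩, fun y hy => Set.mem_iInter.2 fun j => hxU j (hx y hy j j.2)⟩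

/-- If the first `l` bits of a point determine its itinerary, the number of itineraries is at most
`2 ^ l`. -/
theorem minSubcoverCard_le_two_pow {𝒰 : Set (Set (ℕ → Bool))} {n k l : ℕ}
    (hn : ∀ x, ∃ U ∈ 𝒰, cylinder x n ⊆ U)
    (h : ∀ x, ∀ y ∈ cylinder x l, ∀ j < k, f^[j] y ∈ cylinder (f^[j] x) n) :
    minSubcoverCard f 𝒰 k ≤ 2 ^ l := by
  refine (minSubcoverCard_le_of_itinerary hn (fun w : Fin l → Bool => cylinder (padFalse w) l)
    (fun x => ⟨_, mem_cylinder_padFalse x l⟩) ?_).trans_eq (by simp)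
  intro w x hx y hy
  exact h x y ((cylinder_eq_of_mem hx).symm ▸ hy)

/-- Points with distinct itineraries bound the minimal cardinality of a sub-cover from below. -/
theorem card_le_minSubcoverCard {n k : ℕ} {ι : Type*} [Fintype ι] (g : ι → ℕ → Bool)
    (h : ∀ a b, (∀ j < k, f^[j] (g b) ∈ cylinder (f^[j] (g a)) n) → a = b) :
    Fintype.card ι ≤ minSubcoverCard f (cylinderPartition n) k := by
  classical
  obtain ⟨s, hs, hc, hcard⟩ := exists_minimal_subcover (f := f) (finite_cylinderPartition n)
    (sUnion_cylinderPartition n) k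
  have : ∀ a, ∃ V ∈ s, g a ∈ V := fun a => by
    obtain ⟨V, hV, hx⟩ : g a ∈ ⋃₀ (s : Set (Set (ℕ → Bool))) := hc ▸ trivial
    exact ⟨V, hV, hx⟩
  choose V hV hg using this
  rw [← hcard, ← Finset.card_univ]
  refine Finset.card_le_card_of_injOn V (fun a _ => hV a) ?_
  intro a _ b _ hab
  refine h a b fun j hj => ?_
  obtain ⟨U, hU, hVU⟩ := hs (hV a)
  obtain ⟨x, hx⟩ := hU ⟨j, hj⟩
  have hga := hg a
  have hgb := hg b
  rw [← hab] at hgb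
  rw [hVU] at hga hgb
  have h1 := Set.mem_iInter.1 hga ⟨j, hj⟩
  have h2 := Set.mem_iInter.1 hgb ⟨j, hj⟩
  rw [Set.mem_preimage, ← hx] at h1 h2
  exact (cylinder_eq_of_mem h1).symm ▸ h2

/-- On a member of the join of a partition the itinerary is constant, so a minimal sub-cover for the
finer partition serves as the covering family of `minSubcoverCard_le_of_itinerary`. -/
theorem entropyRelCover_le_cylinderPartition {𝒰 : Set (Set (ℕ → Bool))} {n : ℕ}
    (hf : 𝒰.Finite) (hc : ⋃₀ 𝒰 = Set.univ) (hn : ∀ x, ∃ U ∈ 𝒰, cylinder x n ⊆ U) :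
    entropyRelCover f 𝒰 ≤ entropyRelCover f (cylinderPartition n) := by
  refine le_ciInf fun k => (entropyRelCover_le k).trans ?_
  gcongr
  · norm_num
  · exact_mod_cast minSubcoverCard_pos hf hc (k + 1)
  obtain ⟨s, hs, hcs, hcard⟩ := exists_minimal_subcover (f := f) (finite_cylinderPartition n)
    (sUnion_cylinderPartition n) (k + 1)
  rw [← hcard, ← Fintype.card_coe]
  refine minSubcoverCard_le_of_itinerary hn (fun V : s => (V : Set (ℕ → Bool))) ?_ ?_
  · intro x
    obtain ⟨V, hV, hx⟩ : x ∈ ⋃₀ (s : Set (Set (ℕ → Bool))) := hcs ▸ trivial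
    exact ⟨⟨V, hV⟩, hx⟩
  · rintro ⟨V, hV⟩ x hx y hy j hj
    obtain ⟨U, hU, rfl⟩ := hs hV
    obtain ⟨z, hz⟩ := hU ⟨j, hj⟩
    have h1 := Set.mem_iInter.1 hx ⟨j, hj⟩
    have h2 := Set.mem_iInter.1 hy ⟨j, hj⟩
    rw [Set.mem_preimage, ← hz] at h1 h2
    exact (cylinder_eq_of_mem h1).symm ▸ h2

/-- The topological entropy of a map of the Cantor space is the supremum of its entropies relative
to the cylinder partitions. -/
theorem topologicalEntropy_eq_iSup_cylinderPartition (f : (ℕ → Bool) → (ℕ → Bool)) :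
    topologicalEntropy f = ⨆ n, (entropyRelCover f (cylinderPartition n) : EReal) := by
  refine le_antisymm (iSup₂_le fun 𝒰 h𝒰 => ?_) (iSup_le fun n => ?_)
  · obtain ⟨n, hn⟩ := exists_cylinder_refinement h𝒰.2.1 h𝒰.2.2
    refine le_iSup_of_le n ?_
    exact_mod_cast entropyRelCover_le_cylinderPartition h𝒰.1 h𝒰.2.2 hn
  · exact le_iSup₂_of_le (cylinderPartition n) ⟨finite_cylinderPartition n,
      fun U => isOpen_of_mem_cylinderPartition, sUnion_cylinderPartition n⟩ le_rfl

/-! ### Recursion-theoretic preliminaries -/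

theorem Primrec.nat_pow : Primrec₂ ((· ^ ·) : ℕ → ℕ → ℕ) :=
  Primrec₂.unpaired'.1 Nat.Primrec.pow

/-- The encoding of `ℤ` puts nonnegative integers at even codes and negative ones at odd codes. On
codes, the cast from `ℕ` is doubling, and `Int.toNat` halves even codes and sends odd ones to 0. -/
theorem encode_negSucc_int (n : ℕ) : Encodable.encode (Int.negSucc n) = 2 * n + 1 := by
  rfl

theorem primrec_intCast : Primrec fun n : ℕ => (n : ℤ) :=
  Primrec.encode_iff.1 (Primrec.nat_mul.comp (Primrec.const 2) Primrec.id)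

theorem primrec_intToNat : Primrec Int.toNat := by
  refine (Primrec.ite (c := fun z : ℤ => Encodable.encode z % 2 = 0)
    (Primrec.eq.comp (Primrec.nat_mod.comp Primrec.encode (Primrec.const 2)) (Primrec.const 0))
    (Primrec.nat_div.comp Primrec.encode (Primrec.const 2)) (Primrec.const 0)).of_eq fun z => ?_
  rcases z with n | n
  · have : Encodable.encode (Int.ofNat n) = 2 * n := rfl
    rw [this, if_pos (by lia)]
    simp
  · rw [encode_negSucc_int, if_neg (by lia)]
    simp

/-- A recursively enumerable predicate is the increasing union of uniformly primitive recursive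
ones. -/
theorem REPred.exists_primrec_approximation {α : Type*} [Primcodable α] {p : α → Prop}
    (h : REPred p) : ∃ r : ℕ × α → Prop, PrimrecPred r ∧ (∀ a, p a ↔ ∃ t, r (t, a)) ∧
      ∀ s t a, s ≤ t → r (s, a) → r (t, a) := by
  obtain ⟨c, hc⟩ := Nat.Partrec.Code.exists_code.1 h
  -- Stage `t` asks whether a program for `p` halts with fuel `t`; this is primitive recursive and
  -- monotone in the fuel.
  refine ⟨fun x => (Nat.Partrec.Code.evaln x.1 c (Encodable.encode x.2)).isSome = true,
    ?_, ?_, ?_⟩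
  · refine Primrec.primrecPred (p := fun x : ℕ × α =>
      (Nat.Partrec.Code.evaln x.1 c (Encodable.encode x.2)).isSome = true) ?_
    have : Primrec fun x : ℕ × α => (Nat.Partrec.Code.evaln x.1 c (Encodable.encode x.2)).isSome :=
      Primrec.option_isSome.comp (Nat.Partrec.Code.primrec_evaln.comp
        ((Primrec.fst.pair (Primrec.const c)).pair (Primrec.encode.comp Primrec.snd)))
    exact this.of_eq fun x => by simp
  · intro a
    have hdom : (Nat.Partrec.Code.eval c (Encodable.encode a)).Dom ↔ p a := by
      rw [hc]
      simp [Part.assert]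
    rw [← hdom, Part.dom_iff_mem]
    constructor
    · rintro ⟨y, hy⟩
      obtain ⟨t, ht⟩ := Nat.Partrec.Code.evaln_complete.1 hy
      exact ⟨t, Option.isSome_iff_exists.2 ⟨y, ht⟩⟩
    · rintro ⟨t, ht⟩
      obtain ⟨y, hy⟩ := Option.isSome_iff_exists.1 ht
      exact ⟨y, Nat.Partrec.Code.evaln_sound hy⟩
  · intro s t a hst hs
    obtain ⟨y, hy⟩ := Option.isSome_iff_exists.1 hs
    exact Option.isSome_iff_exists.2 ⟨y, Nat.Partrec.Code.evaln_mono hst hy⟩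

/-! ### Finite words and entropy certificates -/

/-- The word of the first `n` bits of `x`. -/
def initialWord (x : ℕ → Bool) (n : ℕ) : List Bool := (List.range n).map x

@[simp]
theorem length_initialWord (x : ℕ → Bool) (n : ℕ) : (initialWord x n).length = n := by
  simp [initialWord]

@[simp]
theorem getElem_initialWord (x : ℕ → Bool) (n i : ℕ) (hi : i < (initialWord x n).length) :
    (initialWord x n)[i] = x i := by
  simp [initialWord]

theorem mem_binaryCylinder_iff {x : ℕ → Bool} {w : List Bool} :
    x ∈ binaryCylinder w ↔ initialWord x w.length = w := by
  constructor
  · intro h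
    refine List.ext_getElem (by simp) fun i h1 h2 => ?_
    simpa using h i h2
  · intro h i hi
    have : (initialWord x w.length)[i]'(by simpa using hi) = w[i] := by simp [h]
    simpa using this

theorem mem_cylinder_iff_initialWord {x y : ℕ → Bool} {n : ℕ} :
    y ∈ cylinder x n ↔ initialWord y n = initialWord x n := by
  rw [mem_cylinder_iff]
  constructor
  · intro h
    exact List.ext_getElem (by simp) fun i h1 h2 => by simpa using h i (by simpa using h1)
  · intro h i hi
    have : (initialWord y n)[i]'(by simpa using hi) = (initialWord x n)[i]'(by simpa using hi) := by
      simp [h]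
    simpa using this

theorem binaryCylinder_initialWord (x : ℕ → Bool) (n : ℕ) :
    binaryCylinder (initialWord x n) = cylinder x n := by
  ext y
  rw [mem_binaryCylinder_iff, mem_cylinder_iff_initialWord, length_initialWord]

theorem take_initialWord (x : ℕ → Bool) {m n : ℕ} (h : m ≤ n) :
    (initialWord x n).take m = initialWord x m := by
  rw [initialWord, ← List.map_take, List.take_range, min_eq_left h, initialWord]

/-- All binary words of length `n`. -/
def wordsOfLength (n : ℕ) : List (List Bool) :=
  Nat.rec [[]] (fun _ l => l.flatMap fun w => [false :: w, true :: w]) n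

theorem mem_wordsOfLength {n : ℕ} {w : List Bool} : w ∈ wordsOfLength n ↔ w.length = n := by
  induction n generalizing w with
  | zero => simp [wordsOfLength]
  | succ n ih =>
    have : wordsOfLength (n + 1) = (wordsOfLength n).flatMap fun w => [false :: w, true :: w] := rfl
    rw [this, List.mem_flatMap]
    cases w with
    | nil => simp
    | cons b w => cases b <;> simp [ih]

theorem primrec_wordsOfLength : Primrec wordsOfLength := by
  refine Primrec.nat_rec₁ _ (Primrec.list_flatMap Primrec.snd ?_)
  exact Primrec.list_cons.comp (Primrec.list_cons.comp (Primrec.const false) Primrec.snd)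
    (Primrec.list_cons.comp (Primrec.list_cons.comp (Primrec.const true) Primrec.snd)
      (Primrec.const []))

/-- `c` lists `k + 1` words of length at least `n`, and the stage `t` of the enumeration `r` shows
that the map sends the cylinder of each word into the cylinder of the next one. -/
def IsWordChain (r : ℕ × List Bool × List Bool → Prop) (t n k : ℕ) (c : List (List Bool)) : Prop :=
  c.length = k + 1 ∧ (∀ w ∈ c, n ≤ w.length) ∧
    ∀ j < k, ∃ m < (c.getD j []).length + 1, r (t, c.getD (j + 1) [], (c.getD j []).take m)

/-- The data showing that a map has few itineraries: a level `l`, a time `k`, a list `D` of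
itineraries, a list of chains of words, and `p`, `q` such that `D.length ^ q ≤ 2 ^ p`. -/
abbrev EntropyCertificate : Type :=
  ℕ × ℕ × List (List (List Bool)) × List (List (List Bool)) × ℕ × ℕ

/-- The certificate is correct for the precision `n`. -/
def EntropyCertificate.IsValid (r : ℕ × List Bool × List Bool → Prop) (n : ℕ) :
    EntropyCertificate → Prop
  | (l, k, D, L, p, q) => (∀ w ∈ wordsOfLength l, ∃ c ∈ L, c.getD 0 [] = w) ∧
    (∀ c ∈ L, IsWordChain r l n k c ∧ c.map (List.take n) ∈ D) ∧ 1 ≤ q ∧ D.length ^ q ≤ 2 ^ p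

/-! ### Validity of a certificate is primitive recursive -/

section Primrec

variable {α β γ : Type*} [Primcodable α] [Primcodable β] [Primcodable γ]

theorem PrimrecPred.forall_mem_list_of {f : α → List β} {R : β → α → Prop} (hf : Primrec f)
    (hR : PrimrecRel R) : PrimrecPred fun a => ∀ b ∈ f a, R b a :=
  (PrimrecRel.forall_mem_list hR).comp hf Primrec.id

theorem PrimrecPred.exists_mem_list_of {f : α → List β} {R : β → α → Prop} (hf : Primrec f)
    (hR : PrimrecRel R) : PrimrecPred fun a => ∃ b ∈ f a, R b a :=
  (PrimrecRel.exists_mem_list hR).comp hf Primrec.id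

theorem PrimrecPred.forall_lt_of {f : α → ℕ} {R : ℕ → α → Prop} (hf : Primrec f)
    (hR : PrimrecRel R) : PrimrecPred fun a => ∀ b < f a, R b a :=
  (PrimrecPred.forall_mem_list_of (Primrec.list_range.comp hf) hR).of_eq fun a => by simp

theorem PrimrecPred.exists_lt_of {f : α → ℕ} {R : ℕ → α → Prop} (hf : Primrec f)
    (hR : PrimrecRel R) : PrimrecPred fun a => ∃ b < f a, R b a :=
  (PrimrecPred.exists_mem_list_of (Primrec.list_range.comp hf) hR).of_eq fun a => by simp

theorem primrecPred_mem_list {f : α → β} {l : α → List β} (hf : Primrec f) (hl : Primrec l) :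
    PrimrecPred fun a => f a ∈ l a := by
  refine (PrimrecPred.exists_mem_list_of (R := fun b a => b = f a) hl
    (Primrec.eq.comp Primrec.fst (hf.comp Primrec.snd))).of_eq fun a => ?_
  simp

theorem primrecPred_isWordChain {r : ℕ × List Bool × List Bool → Prop} (hr : PrimrecPred r) :
    PrimrecPred fun x : ℕ × ℕ × ℕ × List (List Bool) =>
      IsWordChain r x.1 x.2.1 x.2.2.1 x.2.2.2 := by
  have ht : Primrec fun x : ℕ × ℕ × ℕ × List (List Bool) => x.1 := Primrec.fst
  have hn : Primrec fun x : ℕ × ℕ × ℕ × List (List Bool) => x.2.1 :=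
    Primrec.fst.comp Primrec.snd
  have hk : Primrec fun x : ℕ × ℕ × ℕ × List (List Bool) => x.2.2.1 :=
    Primrec.fst.comp (Primrec.snd.comp Primrec.snd)
  have hc : Primrec fun x : ℕ × ℕ × ℕ × List (List Bool) => x.2.2.2 :=
    Primrec.snd.comp (Primrec.snd.comp Primrec.snd)
  refine (Primrec.eq.comp (Primrec.list_length.comp hc) (Primrec.succ.comp hk)).and
    (PrimrecPred.and ?_ ?_)
  · exact PrimrecPred.forall_mem_list_of hc (Primrec.nat_le.comp (hn.comp Primrec.snd)
      (Primrec.list_length.comp Primrec.fst))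
  · refine PrimrecPred.forall_lt_of (R := fun j x => ∃ m < (x.2.2.2.getD j []).length + 1,
      r (x.1, x.2.2.2.getD (j + 1) [], (x.2.2.2.getD j []).take m)) hk ?_
    have hj : Primrec fun y : ℕ × ℕ × ℕ × ℕ × List (List Bool) => y.2.2.2.2.getD y.1 [] :=
      (Primrec.list_getD []).comp (hc.comp Primrec.snd) Primrec.fst
    have hj' : Primrec fun y : ℕ × ℕ × ℕ × ℕ × List (List Bool) => y.2.2.2.2.getD (y.1 + 1) [] :=
      (Primrec.list_getD []).comp (hc.comp Primrec.snd) (Primrec.succ.comp Primrec.fst)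
    exact PrimrecPred.exists_lt_of (f := fun y : ℕ × ℕ × ℕ × ℕ × List (List Bool) =>
        (y.2.2.2.2.getD y.1 []).length + 1)
      (R := fun m y => r (y.2.1, y.2.2.2.2.getD (y.1 + 1) [], (y.2.2.2.2.getD y.1 []).take m))
      (Primrec.succ.comp (Primrec.list_length.comp hj))
      (hr.comp ((ht.comp (Primrec.snd.comp Primrec.snd)).pair ((hj'.comp Primrec.snd).pair
        (Primrec.list_take.comp Primrec.fst (hj.comp Primrec.snd)))))

theorem primrecPred_entropyCertificate_isValid {r : ℕ × List Bool × List Bool → Prop}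
    (hr : PrimrecPred r) :
    PrimrecPred fun x : ℕ × EntropyCertificate => x.2.IsValid r x.1 := by
  have hn : Primrec fun x : ℕ × EntropyCertificate => x.1 := Primrec.fst
  have hl : Primrec fun x : ℕ × EntropyCertificate => x.2.1 := Primrec.fst.comp Primrec.snd
  have h2 : Primrec fun x : ℕ × EntropyCertificate => x.2.2 := Primrec.snd.comp Primrec.snd
  have hk : Primrec fun x : ℕ × EntropyCertificate => x.2.2.1 := Primrec.fst.comp h2
  have h3 : Primrec fun x : ℕ × EntropyCertificate => x.2.2.2 := Primrec.snd.comp h2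
  have hD : Primrec fun x : ℕ × EntropyCertificate => x.2.2.2.1 := Primrec.fst.comp h3
  have h4 : Primrec fun x : ℕ × EntropyCertificate => x.2.2.2.2 := Primrec.snd.comp h3
  have hL : Primrec fun x : ℕ × EntropyCertificate => x.2.2.2.2.1 := Primrec.fst.comp h4
  have h5 : Primrec fun x : ℕ × EntropyCertificate => x.2.2.2.2.2 := Primrec.snd.comp h4
  refine PrimrecPred.and ?_ (PrimrecPred.and ?_ (PrimrecPred.and ?_ ?_))
  · refine PrimrecPred.forall_mem_list_of (R := fun w (x : ℕ × EntropyCertificate) =>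
      ∃ c ∈ x.2.2.2.2.1, c.getD 0 [] = w) (primrec_wordsOfLength.comp hl) ?_
    exact PrimrecPred.exists_mem_list_of
      (f := fun y : List Bool × ℕ × EntropyCertificate => y.2.2.2.2.2.1)
      (R := fun c y => c.getD 0 [] = y.1) (hL.comp Primrec.snd)
      (Primrec.eq.comp ((Primrec.list_getD []).comp Primrec.fst (Primrec.const 0))
        (Primrec.fst.comp Primrec.snd))
  · refine PrimrecPred.forall_mem_list_of (R := fun c (x : ℕ × EntropyCertificate) =>
      IsWordChain r x.2.1 x.1 x.2.2.1 c ∧ c.map (List.take x.1) ∈ x.2.2.2.1) hL ?_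
    refine PrimrecPred.and ?_ ?_
    · exact (primrecPred_isWordChain hr).comp ((hl.comp Primrec.snd).pair
        ((hn.comp Primrec.snd).pair ((hk.comp Primrec.snd).pair Primrec.fst)))
    · exact primrecPred_mem_list (Primrec.list_map Primrec.fst (Primrec.list_take.comp
        (hn.comp (Primrec.snd.comp Primrec.fst)) Primrec.snd)) (hD.comp Primrec.snd)
  · exact Primrec.nat_le.comp (Primrec.const 1) (Primrec.snd.comp h5)
  · exact Primrec.nat_le.comp
      (Primrec.nat_pow.comp (Primrec.list_length.comp hD) (Primrec.snd.comp h5))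
      (Primrec.nat_pow.comp (Primrec.const 2) (Primrec.fst.comp h5))

end Primrec

/-! ### Soundness and completeness of certificates -/

theorem refines_cylinderPartition (n : ℕ) (x : ℕ → Bool) :
    ∃ U ∈ cylinderPartition n, cylinder x n ⊆ U :=
  ⟨_, ⟨x, rfl⟩, subset_rfl⟩

section Certificates

variable {f : (ℕ → Bool) → (ℕ → Bool)} {R : List Bool → List Bool → Prop}
  {r : ℕ × List Bool × List Bool → Prop}

/-- A prefix of each word is enumerated as a ball inside the preimage of the cylinder of the next
word, and the cylinder of a word lies in that of any prefix. -/
theorem IsWordChain.iterate_mem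
    (hR : ∀ v, f ⁻¹' binaryCylinder v = ⋃ u ∈ {u | R v u}, binaryCylinder u)
    (hr : ∀ t v u, r (t, v, u) → R v u) {t n k : ℕ} {c : List (List Bool)}
    (hc : IsWordChain r t n k c) {x : ℕ → Bool} (hx : x ∈ binaryCylinder (c.getD 0 [])) {j : ℕ}
    (hj : j ≤ k) : f^[j] x ∈ binaryCylinder (c.getD j []) := by
  induction j with
  | zero => exact hx
  | succ j ih =>
    obtain ⟨m, -, hm⟩ := hc.2.2 j hj
    rw [iterate_succ_apply']
    rw [← Set.mem_preimage, hR]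
    refine Set.mem_biUnion (hr _ _ _ hm) fun i hi => ?_
    have := ih (by lia) i (by rw [List.length_take] at hi; lia)
    rw [this, List.getElem_take]

/-- Soundness. The chain headed by the first `l` bits of `x` displays the itinerary of `x`, which is
therefore listed in `D`; the sets of points with itinerary `D[i]` cover the space, and `D.length ^ q
≤ 2 ^ p` bounds the logarithm of their number by `p / q`. -/
theorem entropyRelCover_le_of_isValid
    (hR : ∀ v, f ⁻¹' binaryCylinder v = ⋃ u ∈ {u | R v u}, binaryCylinder u)
    (hr : ∀ t v u, r (t, v, u) → R v u) {n l k p q : ℕ} {D L : List (List (List Bool))}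
    (h : EntropyCertificate.IsValid r n (l, k, D, L, p, q)) :
    entropyRelCover f (cylinderPartition n) ≤ (p : ℝ) / (q * (k + 1) : ℕ) := by
  obtain ⟨h1, h2, hq, hpq⟩ := h
  have hN : minSubcoverCard f (cylinderPartition n) (k + 1) ≤ D.length := by
    rw [← Fintype.card_fin D.length]
    refine minSubcoverCard_le_of_itinerary (n := n) (refines_cylinderPartition n)
      (fun i => {x : ℕ → Bool | ∀ j ≤ k, initialWord (f^[j] x) n = (D[i]).getD j []}) ?_ ?_
    · intro x
      obtain ⟨c, hc, hcx⟩ := h1 (initialWord x l) (mem_wordsOfLength.2 (by simp))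
      obtain ⟨hch, hcD⟩ := h2 c hc
      obtain ⟨i, hi, hDi⟩ := List.mem_iff_getElem.1 hcD
      refine ⟨⟨i, hi⟩, fun j hj => ?_⟩
      have hmem := hch.iterate_mem hR hr (x := x)
        (by rw [hcx, binaryCylinder_initialWord]; exact self_mem_cylinder x l) hj
      have hjc : j < c.length := by rw [hch.1]; lia
      have hlen : n ≤ (c.getD j []).length := by
        rw [List.getD_eq_getElem _ _ hjc]
        exact hch.2.1 _ (List.getElem_mem hjc)
      rw [mem_binaryCylinder_iff] at hmem
      rw [Fin.getElem_fin, hDi, List.getD_eq_getElem _ _ (by simpa using hjc), List.getElem_map,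
        ← List.getD_eq_getElem _ [] hjc, ← hmem, take_initialWord _ hlen]
    · intro i x hx y hy j hj
      rw [mem_cylinder_iff_initialWord, hx j (by lia), hy j (by lia)]
  have hN0 : 0 < minSubcoverCard f (cylinderPartition n) (k + 1) :=
    minSubcoverCard_pos (finite_cylinderPartition n) (sUnion_cylinderPartition n) _
  have hlog : Real.logb 2 (minSubcoverCard f (cylinderPartition n) (k + 1) : ℝ) ≤ (p : ℝ) / q := by
    rw [le_div_iff₀ (by exact_mod_cast hq), mul_comm, ← Real.logb_pow]
    rw [Real.logb_le_iff_le_rpow (by norm_num) (by positivity), Real.rpow_natCast]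
    exact_mod_cast (Nat.pow_le_pow_left hN q).trans hpq
  calc _ ≤ _ := entropyRelCover_le k
    _ ≤ (p : ℝ) / q / ((k : ℝ) + 1) := by gcongr
    _ = _ := by push_cast; rw [div_div]

/-- Around every point, for all large `m`, points have a chain headed by their first `m` bits. -/
theorem exists_isWordChain
    (hR : ∀ v, f ⁻¹' binaryCylinder v = ⋃ u ∈ {u | R v u}, binaryCylinder u)
    (hr : ∀ v u, R v u → ∃ t, r (t, v, u)) (hmono : ∀ s t a, s ≤ t → r (s, a) → r (t, a))
    (n k : ℕ) (x : ℕ → Bool) : ∃ l, ∀ y ∈ cylinder x l, ∀ m ≥ l, ∃ c, IsWordChain r m n k c ∧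
      c.getD 0 [] = initialWord y m ∧
      c.map (List.take n) = (List.range (k + 1)).map fun j => initialWord (f^[j] y) n := by
  induction k generalizing x with
  | zero =>
    refine ⟨n, fun y _ m hm => ⟨[initialWord y m], ⟨by simp, by simpa using hm, by simp⟩,
      by simp, ?_⟩⟩
    simp [take_initialWord y hm]
  | succ k ih =>
    obtain ⟨l', hl'⟩ := ih (f x)
    have hfx : x ∈ f ⁻¹' binaryCylinder (initialWord (f x) l') := by
      rw [binaryCylinder_initialWord]
      exact self_mem_cylinder _ _
    rw [hR] at hfx
    obtain ⟨u, hu, hxu⟩ := Set.mem_iUnion₂.1 hfx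
    obtain ⟨t, ht⟩ := hr _ _ hu
    refine ⟨max (max n u.length) (max t l'), fun y hy m hm => ?_⟩
    simp only [ge_iff_le, max_le_iff] at hm
    have hyu : y ∈ binaryCylinder u := fun i hi => by
      rw [hy i (by simp; lia), hxu i hi]
    have hfy : f y ∈ cylinder (f x) l' := by
      rw [← binaryCylinder_initialWord]
      rw [← Set.mem_preimage, hR]
      exact Set.mem_biUnion hu hyu
    obtain ⟨c, ⟨hlen, hcn, hstep⟩, hhead, hitin⟩ := hl' (f y) hfy l' le_rfl
    -- Only the head word grows with `m`. The tail is the chain of `f y` at the fixed level `l'`,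
    -- whose head is the same for all `y` near `x`, so a single enumerated ball `u` links the two.
    refine ⟨initialWord y m :: c, ⟨by simp [hlen], ?_, ?_⟩, by simp, ?_⟩
    · simpa using ⟨hm.1.1, hcn⟩
    · rintro (_ | j) hj
      · refine ⟨u.length, by simp; lia, ?_⟩
        simp only [zero_add, List.getD_cons_zero, List.getD_cons_succ, hhead]
        rw [take_initialWord y hm.1.2, mem_binaryCylinder_iff.1 hyu,
          mem_cylinder_iff_initialWord.1 hfy]
        exact hmono _ _ _ hm.2.1 ht
      · obtain ⟨i, hi, hri⟩ := hstep j (by lia)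
        exact ⟨i, by simpa using hi, hmono _ _ _ hm.2.2 (by simpa using hri)⟩
    · rw [List.map_cons, hitin, take_initialWord y hm.1.1, List.range_succ_eq_map (n := k + 1)]
      simp [Function.comp_def]

/-- Completeness. `exists_uniform_level` makes the local chains available at one level, used both as
word length and as enumeration stage. `D` takes one itinerary from each member of a minimal
sub-cover, so its length is exactly the minimal cardinality, however many chains there are. -/
theorem exists_isValid
    (hR : ∀ v, f ⁻¹' binaryCylinder v = ⋃ u ∈ {u | R v u}, binaryCylinder u)
    (hr : ∀ v u, R v u → ∃ t, r (t, v, u)) (hmono : ∀ s t a, s ≤ t → r (s, a) → r (t, a))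
    {n k p q : ℕ} (hq : 1 ≤ q)
    (hpq : minSubcoverCard f (cylinderPartition n) (k + 1) ^ q ≤ 2 ^ p) :
    ∃ l D L, EntropyCertificate.IsValid r n (l, k, D, L, p, q) := by
  classical
  obtain ⟨s, hs, hc, hcard⟩ := exists_minimal_subcover (f := f) (finite_cylinderPartition n)
    (sUnion_cylinderPartition n) (k + 1)
  let itin : (ℕ → Bool) → List (List Bool) := fun y =>
    (List.range (k + 1)).map fun j => initialWord (f^[j] y) n
  have hV : ∀ V : Set (ℕ → Bool), ∃ d, V ∈ s → ∀ x ∈ V, itin x = d := by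
    intro V
    rcases V.eq_empty_or_nonempty with rfl | ⟨y, hy⟩
    · exact ⟨[], by simp⟩
    · refine ⟨itin y, fun hVs x hx => List.map_congr_left fun j hj => ?_⟩
      obtain ⟨U, hU, rfl⟩ := hs hVs
      have hj : j < k + 1 := List.mem_range.1 hj
      obtain ⟨z, hz⟩ := hU ⟨j, hj⟩
      have h1 := Set.mem_iInter.1 hx ⟨j, hj⟩
      have h2 := Set.mem_iInter.1 hy ⟨j, hj⟩
      rw [Set.mem_preimage, ← hz] at h1 h2
      exact (mem_cylinder_iff_initialWord.1 h1).trans (mem_cylinder_iff_initialWord.1 h2).symm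
  choose d hd using hV
  obtain ⟨l, hl⟩ := exists_uniform_level (exists_isWordChain (n := n) (k := k) hR hr hmono)
  choose c hchain hhead hitin using hl l le_rfl
  refine ⟨l, s.toList.map d, (wordsOfLength l).map fun w => c fun i => w.getD i false,
    ?_, ?_, hq, ?_⟩
  · intro w hw
    refine ⟨_, List.mem_map_of_mem hw, ?_⟩
    rw [hhead]
    have hwl := mem_wordsOfLength.1 hw
    exact List.ext_getElem (by simp [hwl]) fun i h1 h2 => by
      rw [getElem_initialWord, List.getD_eq_getElem _ _ h2]
  · intro c' hc'
    obtain ⟨w, -, rfl⟩ := List.mem_map.1 hc'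
    refine ⟨hchain _, ?_⟩
    obtain ⟨V, hVs, hxV⟩ : (fun i => w.getD i false) ∈ ⋃₀ (s : Set (Set (ℕ → Bool))) := hc ▸ trivial
    rw [hitin]
    exact List.mem_map.2 ⟨V, by simpa using hVs, (hd V hVs _ hxV).symm⟩
  · simpa [hcard] using hpq

end Certificates

/-! ### The entropy of a computable map is Σ₂ -/

/-- Powers of two approximate powers of `N` well enough to compute `logb 2 N` from above. -/
theorem exists_pow_le_two_pow {N : ℕ} (hN : 0 < N) {ε : ℝ} (hε : 0 < ε) :
    ∃ p q : ℕ, 1 ≤ q ∧ N ^ q ≤ 2 ^ p ∧ (p : ℝ) / q ≤ Real.logb 2 N + ε := by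
  obtain ⟨m, hm⟩ := exists_nat_one_div_lt hε
  have hlog : 0 ≤ Real.logb 2 N := Real.logb_nonneg (by norm_num) (by exact_mod_cast hN)
  have hm0 : (0 : ℝ) < ((m + 1 : ℕ) : ℝ) := by positivity
  -- Rounding `q * logb 2 N` up to an integer costs at most 1, hence at most `1 / q < ε` after
  -- division by `q = m + 1`.
  refine ⟨⌈((m + 1 : ℕ) : ℝ) * Real.logb 2 N⌉₊, m + 1, by lia, ?_, ?_⟩
  · have h1 := Nat.le_ceil (((m + 1 : ℕ) : ℝ) * Real.logb 2 N)
    rw [← Real.logb_pow, Real.logb_le_iff_le_rpow (by norm_num) (by positivity),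
      Real.rpow_natCast] at h1
    rw [← Real.logb_pow]
    exact_mod_cast h1
  · have h1 := Nat.ceil_lt_add_one (mul_nonneg hm0.le hlog)
    rw [div_le_iff₀ hm0]
    have : 1 ≤ ε * ((m + 1 : ℕ) : ℝ) := by
      rw [div_lt_iff₀ (by positivity)] at hm
      push_cast
      linarith
    nlinarith

theorem entropyRelCover_cylinderPartition_le (f : (ℕ → Bool) → (ℕ → Bool)) (n : ℕ) :
    entropyRelCover f (cylinderPartition n) ≤ n := by
  refine (entropyRelCover_le 0).trans ?_
  have h : minSubcoverCard f (cylinderPartition n) 1 ≤ 2 ^ n := by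
    refine minSubcoverCard_le_two_pow (n := n) (refines_cylinderPartition n) ?_
    intro x y hy j hj
    obtain rfl : j = 0 := by lia
    exact hy
  have h0 : 0 < minSubcoverCard f (cylinderPartition n) 1 :=
    minSubcoverCard_pos (finite_cylinderPartition n) (sUnion_cylinderPartition n) _
  simp only [zero_add, Nat.cast_zero, div_one]
  rw [Real.logb_le_iff_le_rpow (by norm_num) (by positivity), Real.rpow_natCast]
  exact_mod_cast h

/-- The entropies of a computable map relative to the cylinder partitions are uniformly computable
from above. -/
theorem exists_isComputableRatDoubleSeq_isGLB {f : (ℕ → Bool) → (ℕ → Bool)}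
    (hf : IsComputableCantorMap f) : ∃ q : ℕ → ℕ → ℚ, IsComputableRatDoubleSeq q ∧
      ∀ n, IsGLB (Set.range fun e => (q n e : ℝ)) (entropyRelCover f (cylinderPartition n)) := by
  classical
  obtain ⟨R, hRE, hR⟩ := hf
  obtain ⟨r, hr, hRr, hmono⟩ := hRE.exists_primrec_approximation
  have hsound : ∀ t v u, r (t, v, u) → R v u := fun t v u h => (hRr (v, u)).2 ⟨t, h⟩
  have hcomplete : ∀ v u, R v u → ∃ t, r (t, v, u) := fun v u h => (hRr (v, u)).1 h
  let cert : ℕ → EntropyCertificate := fun e => (Encodable.decode e).getD default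
  have hcert : Primrec fun x : ℕ × ℕ => (x.1, cert x.2) :=
    Primrec.fst.pair (Primrec.option_getD_default.comp (Primrec.decode.comp Primrec.snd))
  have hvalid := (primrecPred_entropyCertificate_isValid hr).comp hcert
  have hk : Primrec fun x : ℕ × ℕ => (cert x.2).2.1 :=
    Primrec.fst.comp (Primrec.snd.comp (Primrec.snd.comp hcert))
  have hpq : Primrec fun x : ℕ × ℕ => (cert x.2).2.2.2.2 :=
    Primrec.snd.comp (Primrec.snd.comp (Primrec.snd.comp (Primrec.snd.comp (Primrec.snd.comp hcert))))
  -- An invalid code yields the bound `n / 1`, which is always true by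
  -- `entropyRelCover_cylinderPartition_le`, so it does not disturb the infimum.
  let num : ℕ → ℕ → ℕ := fun n e => if (cert e).IsValid r n then (cert e).2.2.2.2.1 else n
  let den : ℕ → ℕ → ℕ := fun n e =>
    if (cert e).IsValid r n then (cert e).2.2.2.2.2 * ((cert e).2.1 + 1) else 1
  have hnum : Computable₂ fun n e => (num n e : ℤ) := by
    have h1 : Primrec fun x : ℕ × ℕ => num x.1 x.2 :=
      Primrec.ite hvalid (Primrec.fst.comp hpq) Primrec.fst
    exact (primrec_intCast.comp h1).to_comp
  have hden : Computable₂ den :=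
    (Primrec.ite hvalid (Primrec.nat_mul.comp (Primrec.snd.comp hpq) (Primrec.succ.comp hk))
      (Primrec.const 1)).to_comp
  have hden0 : ∀ n e, den n e ≠ 0 := by
    intro n e
    by_cases hv : (cert e).IsValid r n
    · simp only [den, if_pos hv]
      generalize cert e = c at hv
      obtain ⟨l, k, D, L, p, q⟩ := c
      exact Nat.mul_ne_zero (Nat.one_le_iff_ne_zero.1 hv.2.2.1) (by lia)
    · simp [den, hv]
  refine ⟨fun n e => (num n e : ℚ) / (den n e : ℚ), ⟨fun n e => (num n e : ℤ), den, hnum, hden,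
    fun n e => ⟨hden0 n e, by simp⟩⟩, fun n => ⟨?_, ?_⟩⟩
  · rintro _ ⟨e, rfl⟩
    push_cast
    by_cases hv : (cert e).IsValid r n
    · simp only [num, den, if_pos hv]
      generalize cert e = c at hv
      obtain ⟨l, k, D, L, p, q⟩ := c
      exact entropyRelCover_le_of_isValid hR hsound hv
    · simp only [num, den, if_neg hv]
      simpa using entropyRelCover_cylinderPartition_le f n
  · intro b hb
    refine le_ciInf fun k => ?_
    have hN : 0 < minSubcoverCard f (cylinderPartition n) (k + 1) :=
      minSubcoverCard_pos (finite_cylinderPartition n) (sUnion_cylinderPartition n) _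
    refine le_of_forall_pos_le_add fun ε hε => ?_
    obtain ⟨p, q, hq, hNq, hle⟩ := exists_pow_le_two_pow hN hε
    obtain ⟨l, D, L, hv⟩ := exists_isValid (r := r) hR hcomplete hmono hq hNq
    have hb' := hb ⟨Encodable.encode ((l, k, D, L, p, q) : EntropyCertificate), rfl⟩
    have hce : cert (Encodable.encode ((l, k, D, L, p, q) : EntropyCertificate)) =
      (l, k, D, L, p, q) := by simp [cert]
    simp only [num, den, hce, if_pos hv] at hb'
    push_cast at hb'
    have hk0 : (1 : ℝ) ≤ (k : ℝ) + 1 := by simp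
    calc b ≤ _ := hb'
      _ = (p : ℝ) / q / ((k : ℝ) + 1) := by rw [div_div]
      _ ≤ (Real.logb 2 (minSubcoverCard f (cylinderPartition n) (k + 1)) + ε) / ((k : ℝ) + 1) := by
        gcongr
      _ ≤ _ := by
        rw [add_div]
        gcongr
        exact div_le_self hε.le hk0

theorem isSigmaTwoComputable_of_topologicalEntropy_eq {f : (ℕ → Bool) → (ℕ → Bool)}
    (hf : IsComputableCantorMap f) {h : ℝ} (hh : topologicalEntropy f = (h : EReal)) :
    IsSigmaTwoComputable h := by
  obtain ⟨q, hq, hglb⟩ := exists_isComputableRatDoubleSeq_isGLB hf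
  rw [topologicalEntropy_eq_iSup_cylinderPartition] at hh
  refine ⟨q, hq, _, hglb, ?_, ?_⟩
  · rintro _ ⟨n, rfl⟩
    have := le_iSup (fun n => (entropyRelCover f (cylinderPartition n) : EReal)) n
    rw [hh] at this
    exact_mod_cast this
  · intro b hb
    have : (h : EReal) ≤ (b : EReal) := hh ▸ iSup_le fun n => by exact_mod_cast hb ⟨n, rfl⟩
    exact_mod_cast this

/-! ### Bounded search for the first `false` -/

/-- The number of leading `true`s among the first `n` terms of `b`. -/
def leadingTrues (b : ℕ → Bool) (n : ℕ) : ℕ :=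
  Nat.rec 0 (fun k i => if i = k ∧ b k = true then k + 1 else i) n

theorem leadingTrues_succ (b : ℕ → Bool) (n : ℕ) : leadingTrues b (n + 1) =
    if leadingTrues b n = n ∧ b n = true then n + 1 else leadingTrues b n := rfl

/-- This single search serves as the carry test of the counter, as the detector of a failed test in
the truncated shift, and as the position of the marker in `1ⁱ 0 z`. -/
theorem leadingTrues_spec (b : ℕ → Bool) (n : ℕ) : leadingTrues b n ≤ n ∧
    (∀ k < leadingTrues b n, b k = true) ∧ (leadingTrues b n < n → b (leadingTrues b n) = false) := by
  induction n with
  | zero => simp [leadingTrues]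
  | succ n ih =>
    rw [leadingTrues_succ]
    split_ifs with h
    · refine ⟨le_rfl, fun k hk => ?_, by simp⟩
      rcases Nat.lt_succ_iff_lt_or_eq.1 hk with hk | rfl
      · exact ih.2.1 k (h.1.symm ▸ hk)
      · exact h.2
    · refine ⟨by lia, ih.2.1, fun hlt => ?_⟩
      rcases ih.1.lt_or_eq with h' | h'
      · exact ih.2.2 h'
      · rw [h']
        simpa [h'] using h

theorem leadingTrues_le (b : ℕ → Bool) (n : ℕ) : leadingTrues b n ≤ n := (leadingTrues_spec b n).1

theorem leadingTrues_eq_self_iff {b : ℕ → Bool} {n : ℕ} :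
    leadingTrues b n = n ↔ ∀ k < n, b k = true := by
  obtain ⟨h1, h2, h3⟩ := leadingTrues_spec b n
  constructor
  · intro h k hk
    exact h2 k (h.symm ▸ hk)
  · intro h
    by_contra hne
    have hlt : leadingTrues b n < n := lt_of_le_of_ne h1 hne
    simp [h _ hlt] at h3
    lia

theorem leadingTrues_eq_of_lt {b : ℕ → Bool} {i n : ℕ} (h : ∀ k < i, b k = true)
    (hi : b i = false) (hn : i < n) : leadingTrues b n = i := by
  obtain ⟨h1, h2, h3⟩ := leadingTrues_spec b n
  rcases lt_trichotomy (leadingTrues b n) i with hlt | heq | hgt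
  · have := h _ hlt
    rw [h3 (hlt.trans hn)] at this
    cases this
  · exact heq
  · have := h2 _ hgt
    rw [hi] at this
    cases this

theorem leadingTrues_congr {b b' : ℕ → Bool} {n : ℕ} (h : ∀ k < n, b k = b' k) :
    leadingTrues b n = leadingTrues b' n := by
  induction n with
  | zero => rfl
  | succ n ih =>
    rw [leadingTrues_succ, leadingTrues_succ, ih fun k hk => h k (by lia), h n (by lia)]

section Computability

variable {α σ : Type*} [Primcodable α] [Primcodable σ]

theorem Computable.ite_of_decide {c : α → Prop} [DecidablePred c] {f g : α → σ}
    (hc : Computable fun a => decide (c a)) (hf : Computable f) (hg : Computable g) :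
    Computable fun a => if c a then f a else g a :=
  (Computable.cond hc hf hg).of_eq fun a => by by_cases h : c a <;> simp [h]

theorem Computable.decide_eq {f g : α → ℕ} (hf : Computable f) (hg : Computable g) :
    Computable fun a => decide (f a = g a) :=
  (PrimrecRel.decide Primrec.eq).to_comp.comp hf hg

theorem Computable.decide_lt {f g : α → ℕ} (hf : Computable f) (hg : Computable g) :
    Computable fun a => decide (f a < g a) :=
  (PrimrecRel.decide Primrec.nat_lt).to_comp.comp hf hg

theorem Computable.nat_add {f g : α → ℕ} (hf : Computable f) (hg : Computable g) :
    Computable fun a => f a + g a :=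
  Primrec.nat_add.to_comp.comp hf hg

theorem Computable.nat_sub {f g : α → ℕ} (hf : Computable f) (hg : Computable g) :
    Computable fun a => f a - g a :=
  Primrec.nat_sub.to_comp.comp hf hg

theorem Computable.bool_and {f g : α → Bool} (hf : Computable f) (hg : Computable g) :
    Computable fun a => f a && g a :=
  Primrec.and.to_comp.comp hf hg

theorem computable_leadingTrues {b : α → ℕ → Bool} {n : α → ℕ} (hb : Computable₂ b)
    (hn : Computable n) : Computable fun a => leadingTrues (b a) (n a) := by
  refine Computable.nat_rec (h := fun a (p : ℕ × ℕ) =>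
    if p.2 = p.1 ∧ b a p.1 = true then p.1 + 1 else p.2) hn (Computable.const 0) ?_
  have h1 : Computable fun x : α × ℕ × ℕ => x.2.1 := Computable.fst.comp Computable.snd
  have h2 : Computable fun x : α × ℕ × ℕ => x.2.2 := Computable.snd.comp Computable.snd
  refine Computable.ite_of_decide (c := fun x : α × ℕ × ℕ => x.2.2 = x.2.1 ∧ b x.1 x.2.1 = true)
    ?_ (Computable.succ.comp h1) h2
  exact ((Computable.decide_eq h2 h1).bool_and (hb.comp Computable.fst h1)).of_eq fun x => by simp

end Computability

/-! ### Truncated shift and odometer -/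

/-- If `T` is the first index where `ok` fails, rotate `{0, …, T + a - 1}` by `a` and fix the other
numbers; if `ok` never fails, translate by `a`. -/
def truncatedShift (a : ℕ) (ok : ℕ → Bool) (n : ℕ) : ℕ :=
  if leadingTrues ok (n + 1) = n + 1 then n + a
  else if n < leadingTrues ok (n + 1) + a then n - leadingTrues ok (n + 1) else n

theorem truncatedShift_of_forall {a : ℕ} {ok : ℕ → Bool} (h : ∀ k, ok k = true) (n : ℕ) :
    truncatedShift a ok n = n + a :=
  if_pos (leadingTrues_eq_self_iff.2 fun k _ => h k)

/-- Although `T` is not known in advance, the tests up to `n` settle whether `n < T`, and if not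
they reveal `T`. -/
theorem truncatedShift_of_first {a T : ℕ} {ok : ℕ → Bool} (h : ∀ k < T, ok k = true)
    (hT : ok T = false) (n : ℕ) :
    truncatedShift a ok n = if n < T then n + a else if n < T + a then n - T else n := by
  rw [truncatedShift]
  by_cases hn : n < T
  · rw [if_pos hn, if_pos (leadingTrues_eq_self_iff.2 fun k hk => h k (by lia))]
  · rw [if_neg hn, leadingTrues_eq_of_lt h hT (by lia), if_neg (by lia)]

theorem exists_first_false {ok : ℕ → Bool} (h : ¬ ∀ k, ok k = true) :
    ∃ T, (∀ k < T, ok k = true) ∧ ok T = false := by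
  classical
  simp only [not_forall, Bool.not_eq_true] at h
  exact ⟨Nat.find h, fun k hk => by simpa using Nat.find_min h hk, Nat.find_spec h⟩

theorem truncatedShift_injective (a : ℕ) (ok : ℕ → Bool) : Injective (truncatedShift a ok) := by
  intro n n' h
  by_cases hok : ∀ k, ok k = true
  · simpa [truncatedShift_of_forall hok] using h
  · obtain ⟨T, h1, h2⟩ := exists_first_false hok
    rw [truncatedShift_of_first h1 h2, truncatedShift_of_first h1 h2] at h
    split_ifs at h <;> lia

theorem truncatedShift_le (a : ℕ) (ok : ℕ → Bool) (n : ℕ) : truncatedShift a ok n ≤ n + a := by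
  rw [truncatedShift]
  split_ifs <;> lia

/-- Adding one with carry, least significant bit first. -/
def odometer (z : ℕ → Bool) (r : ℕ) : Bool := z r ^^ decide (leadingTrues z r = r)

/-- The number whose binary digits are the first `m` bits, least significant bit first. -/
def lowBitsValue (m : ℕ) (z : ℕ → Bool) : ℕ :=
  Nat.rec 0 (fun r c => c + 2 ^ r * (z r).toNat) m

theorem lowBitsValue_succ (m : ℕ) (z : ℕ → Bool) :
    lowBitsValue (m + 1) z = lowBitsValue m z + 2 ^ m * (z m).toNat := rfl

theorem lowBitsValue_lt (m : ℕ) (z : ℕ → Bool) : lowBitsValue m z < 2 ^ m := by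
  induction m with
  | zero => simp [lowBitsValue]
  | succ m ih =>
    rw [lowBitsValue_succ, pow_succ]
    have := Bool.toNat_le (z m)
    nlinarith

theorem lowBitsValue_congr {m : ℕ} {z z' : ℕ → Bool} (h : ∀ r < m, z r = z' r) :
    lowBitsValue m z = lowBitsValue m z' := by
  induction m with
  | zero => rfl
  | succ m ih => rw [lowBitsValue_succ, lowBitsValue_succ, ih fun r hr => h r (by lia), h m (by lia)]

/-- Induction on the carry out of the first `m` bits; the overflow stands on the left so that no
subtraction of naturals occurs. -/
theorem lowBitsValue_odometer (m : ℕ) (z : ℕ → Bool) :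
    lowBitsValue m (odometer z) + (if leadingTrues z m = m then 2 ^ m else 0) =
      lowBitsValue m z + 1 := by
  induction m with
  | zero => simp [lowBitsValue, leadingTrues]
  | succ m ih =>
    have hle := leadingTrues_le z m
    rw [lowBitsValue_succ, lowBitsValue_succ, leadingTrues_succ, odometer, pow_succ]
    by_cases h : leadingTrues z m = m <;> cases hz : z m <;> simp_all <;> lia

theorem odometer_surjective : Surjective odometer := by
  intro w
  -- Subtracting one from `w`: bit `r` is flipped when a borrow reaches it, that is, when all lower
  -- bits of `w` vanish. By `key` this is exactly when the carry reaches bit `r` of `z`.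
  let z : ℕ → Bool := fun r => w r ^^ decide (∀ s < r, w s = false)
  have key : ∀ r, (∀ s < r, z s = true) ↔ ∀ s < r, w s = false := by
    intro r
    induction r with
    | zero => simp
    | succ r ih =>
      rw [Nat.forall_lt_succ_right, Nat.forall_lt_succ_right, ih]
      refine and_congr_right fun h => ?_
      simp only [z, decide_eq_true h]
      simp
  refine ⟨z, funext fun r => ?_⟩
  have : decide (leadingTrues z r = r) = decide (∀ s < r, w s = false) :=
    decide_eq_decide.2 (leadingTrues_eq_self_iff.trans (key r))
  rw [odometer, this]
  simp [z]

/-! ### The counter skew product -/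

/-- The first `m` bits are a counter; when it overflows, the remaining bits are moved along
`φ`. -/
def counterSkew (m : ℕ) (φ : ℕ → ℕ) (z : ℕ → Bool) (r : ℕ) : Bool :=
  if r < m then odometer z r else if leadingTrues z m = m then z (m + φ (r - m)) else z r

theorem counterSkew_congr {m r : ℕ} {φ : ℕ → ℕ} {z z' : ℕ → Bool}
    (h : ∀ s ≤ r, z s = z' s) (h' : m ≤ r → z (m + φ (r - m)) = z' (m + φ (r - m))) :
    counterSkew m φ z r = counterSkew m φ z' r := by
  rw [counterSkew, counterSkew]
  split_ifs with h1 h2 h3 h3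
  · rw [odometer, odometer, h r (by lia), leadingTrues_congr fun k hk => h k (by lia)]
  · exact h' (by lia)
  · exact absurd ((leadingTrues_congr fun k hk => h k (by lia)).symm.trans h2) h3
  · exact absurd ((leadingTrues_congr fun k hk => h k (by lia)).trans h3) h2
  · exact h _ (by lia)

theorem counterSkew_surjective {m : ℕ} {φ : ℕ → ℕ} (hφ : Injective φ) :
    Surjective (counterSkew m φ) := by
  intro w
  obtain ⟨z₀, hz₀⟩ := odometer_surjective w
  let tail : ℕ → Bool := fun r => w (m + r)
  -- The counter is an odometer preimage. If it overflows, the tail of `w` is pulled back along the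
  -- injection `φ`, with arbitrary bits (here `false`) off its range; otherwise the tail is copied.
  let z : ℕ → Bool := fun r => if r < m then z₀ r else
    if leadingTrues z₀ m = m then extend φ tail (fun _ => false) (r - m) else w r
  have hz : ∀ r ≤ m, leadingTrues z r = leadingTrues z₀ r := fun r hr =>
    leadingTrues_congr fun k hk => if_pos (by lia)
  refine ⟨z, funext fun r => ?_⟩
  rw [counterSkew]
  split_ifs with h1 h2
  · rw [odometer, hz r h1.le, ← hz₀, odometer]
    simp [z, h1]
  · rw [hz m le_rfl] at h2
    simp only [z, h2, if_true]
    rw [if_neg (by lia), Nat.add_sub_cancel_left, hφ.extend_apply]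
    simp only [tail]
    rw [Nat.add_sub_cancel' (by lia)]
  · rw [hz m le_rfl] at h2
    simp [z, h1, h2]

theorem lowBitsValue_counterSkew (m : ℕ) (φ : ℕ → ℕ) (z : ℕ → Bool) :
    lowBitsValue m (counterSkew m φ z) + (if leadingTrues z m = m then 2 ^ m else 0) =
      lowBitsValue m z + 1 := by
  rw [← lowBitsValue_odometer,
    lowBitsValue_congr (z := counterSkew m φ z) (z' := odometer z) fun r hr => if_pos hr]

/-! ### Rate of the counter skew product along a translation -/

section Translation

variable {m a : ℕ} {φ : ℕ → ℕ}

/-- The inequality says that `2 ^ m * l - a * c` drops by at most `a`. Without overflow `c` grows by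
1 and `l` stays; with overflow `l` loses at most `a` while `c` falls by `2 ^ m - 1`. -/
theorem exists_counterSkew_mem_cylinder (hφ : ∀ n, φ n = n + a) {z z' : ℕ → Bool} {l : ℕ}
    (h : z' ∈ cylinder z (m + l)) : ∃ l', counterSkew m φ z' ∈ cylinder (counterSkew m φ z) (m + l') ∧
      2 ^ m * l + a * lowBitsValue m (counterSkew m φ z) ≤
        2 ^ m * l' + a * lowBitsValue m z + a := by
  have hlead : leadingTrues z' m = leadingTrues z m := leadingTrues_congr fun k hk => h k (by lia)
  have hval := lowBitsValue_counterSkew m φ z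
  by_cases hc : leadingTrues z m = m
  · refine ⟨l - a, fun r hr => ?_, ?_⟩
    · by_cases hrm : r < m
      · simp only [counterSkew, if_pos hrm, odometer]
        rw [h r (by lia), leadingTrues_congr fun k hk => h k (by lia)]
      · simp only [counterSkew, if_neg hrm, hlead, if_pos hc, hφ]
        exact h _ (by lia)
    · rw [if_pos hc] at hval
      have h1 : l ≤ l - a + a := by lia
      have h2 := Nat.mul_le_mul_left (2 ^ m) h1
      nlinarith
  · refine ⟨l, fun r hr => ?_, ?_⟩
    · by_cases hrm : r < m
      · simp only [counterSkew, if_pos hrm, odometer]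
        rw [h r (by lia), leadingTrues_congr fun k hk => h k (by lia)]
      · simp only [counterSkew, if_neg hrm, hlead, if_neg hc]
        exact h _ hr
    · rw [if_neg hc] at hval
      nlinarith

theorem exists_iterate_counterSkew_mem_cylinder (hφ : ∀ n, φ n = n + a) {z z' : ℕ → Bool} {l : ℕ}
    (h : z' ∈ cylinder z (m + l)) (j : ℕ) :
    ∃ l', (counterSkew m φ)^[j] z' ∈ cylinder ((counterSkew m φ)^[j] z) (m + l') ∧
      2 ^ m * l + a * lowBitsValue m ((counterSkew m φ)^[j] z) ≤
        2 ^ m * l' + a * lowBitsValue m z + a * j := by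
  induction j with
  | zero => exact ⟨l, h, by simp⟩
  | succ j ih =>
    obtain ⟨l', h1, h2⟩ := ih
    obtain ⟨l'', h3, h4⟩ := exists_counterSkew_mem_cylinder hφ h1
    refine ⟨l'', ?_, ?_⟩
    · rw [iterate_succ_apply', iterate_succ_apply']
      exact h3
    · rw [iterate_succ_apply', mul_add_one]
      lia

theorem iterate_counterSkew_mem_cylinder (hφ : ∀ n, φ n = n + a) {z z' : ℕ → Bool} {l n j : ℕ}
    (h : z' ∈ cylinder z (m + l)) (hl : 2 ^ m * n + 2 ^ m * a + a * j ≤ 2 ^ m * l) :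
    (counterSkew m φ)^[j] z' ∈ cylinder ((counterSkew m φ)^[j] z) n := by
  obtain ⟨l', h1, h2⟩ := exists_iterate_counterSkew_mem_cylinder hφ h j
  refine cylinder_anti _ ?_ h1
  have h3 : a * lowBitsValue m z ≤ a * 2 ^ m := Nat.mul_le_mul_left a (lowBitsValue_lt m z).le
  have h4 : 2 ^ m * n ≤ 2 ^ m * l' := by
    rw [mul_comm a (2 ^ m)] at h3
    lia
  have := Nat.le_of_mul_le_mul_left h4 (by positivity)
  lia

/-- The converse estimate: going back one step, `2 ^ m * l - a * c` grows by at least `a`. Agreement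
up to `m + a` is assumed because an overflow discards the `a` bits after the counter. -/
theorem exists_mem_cylinder_of_counterSkew (hφ : ∀ n, φ n = n + a) {z z' : ℕ → Bool} {l : ℕ}
    (h : z' ∈ cylinder z (m + a))
    (hF : counterSkew m φ z' ∈ cylinder (counterSkew m φ z) (m + l)) :
    ∃ l', z' ∈ cylinder z (m + l') ∧ 2 ^ m * l + a * lowBitsValue m z + a ≤
      2 ^ m * l' + a * lowBitsValue m (counterSkew m φ z) := by
  have hlead : leadingTrues z' m = leadingTrues z m := leadingTrues_congr fun k hk => h k (by lia)
  have hval := lowBitsValue_counterSkew m φ z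
  by_cases hc : leadingTrues z m = m
  · refine ⟨l + a, fun r hr => ?_, ?_⟩
    · by_cases hrm : r < m + a
      · exact h r hrm
      · have := hF (r - a) (by lia)
        simp only [counterSkew, if_neg (show ¬ r - a < m by lia), hlead, if_pos hc, hφ] at this
        rwa [show m + (r - a - m + a) = r by lia] at this
    · rw [if_pos hc] at hval
      nlinarith
  · refine ⟨l, fun r hr => ?_, ?_⟩
    · by_cases hrm : r < m
      · exact h r (by lia)
      · simpa only [counterSkew, if_neg hrm, hlead, if_neg hc] using hF r hr
    · rw [if_neg hc] at hval
      nlinarith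

theorem exists_mem_cylinder_of_iterate_counterSkew (hφ : ∀ n, φ n = n + a) (k : ℕ)
    {z z' : ℕ → Bool} (h : ∀ j ≤ k,
      (counterSkew m φ)^[j] z' ∈ cylinder ((counterSkew m φ)^[j] z) (m + a)) :
    ∃ l, z' ∈ cylinder z (m + l) ∧ a * (k + 1) + a * lowBitsValue m z ≤ 2 ^ m * l := by
  induction k generalizing z z' with
  | zero =>
    -- The bound at time 0 is `a + a * c ≤ 2 ^ m * a`, which holds since `c < 2 ^ m`.
    refine ⟨a, h 0 le_rfl, ?_⟩
    have := lowBitsValue_lt m z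
    nlinarith
  | succ k ih =>
    obtain ⟨l, h1, h2⟩ := ih (z := counterSkew m φ z) (z' := counterSkew m φ z')
      fun j hj => h (j + 1) (by lia)
    obtain ⟨l', h3, h4⟩ := exists_mem_cylinder_of_counterSkew hφ (h 0 (by lia)) h1
    refine ⟨l', h3, ?_⟩
    simp only [iterate_zero, id_eq] at h4
    rw [mul_add_one a (k + 1)]
    lia

end Translation

/-- No bit beyond position `m + l` ever enters the first `m + l` positions. This is why truncated
pieces contribute no entropy. -/
theorem iterate_counterSkew_mem_cylinder_of_lt {m l : ℕ} {φ : ℕ → ℕ} (hφ : ∀ n < l, φ n < l)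
    {z z' : ℕ → Bool} (h : z' ∈ cylinder z (m + l)) (j : ℕ) :
    (counterSkew m φ)^[j] z' ∈ cylinder ((counterSkew m φ)^[j] z) (m + l) := by
  induction j with
  | zero => exact h
  | succ j ih =>
    rw [iterate_succ_apply', iterate_succ_apply']
    refine fun r hr => counterSkew_congr (fun s hs => ih s (by lia)) fun hmr => ih _ ?_
    have := hφ (r - m) (by lia)
    lia

/-! ### The union of the counter skew products -/

/-- The map sending `1ⁱ 0 z` to `1ⁱ 0 z'`, where `z'` is the image of `z` under the counter skew
product of `m i` bits along the truncated shift of `a i` and `ok i`; it fixes the sequence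
`1 1 1 …`. -/
def counterUnion (m a : ℕ → ℕ) (ok : ℕ → ℕ → Bool) (x : ℕ → Bool) (p : ℕ) : Bool :=
  if leadingTrues x p = p then x p else
    counterSkew (m (leadingTrues x p))
      (truncatedShift (a (leadingTrues x p)) (ok (leadingTrues x p)))
      (fun s => x (leadingTrues x p + 1 + s)) (p - (leadingTrues x p + 1))

/-- The sequence `1ⁱ 0 z`. -/
def markerCons (i : ℕ) (z : ℕ → Bool) (p : ℕ) : Bool :=
  if p < i then true else if p = i then false else z (p - (i + 1))

theorem markerCons_marker_add (i : ℕ) (z : ℕ → Bool) (s : ℕ) :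
    markerCons i z (i + 1 + s) = z s := by
  rw [markerCons, if_neg (by lia), if_neg (by lia), Nat.add_sub_cancel_left]

theorem eq_const_true_or_exists_markerCons (x : ℕ → Bool) :
    x = (fun _ => true) ∨ ∃ i z, x = markerCons i z := by
  by_cases h : ∀ k, x k = true
  · exact Or.inl (funext h)
  · obtain ⟨i, h1, h2⟩ := exists_first_false h
    refine Or.inr ⟨i, fun s => x (i + 1 + s), funext fun p => ?_⟩
    rw [markerCons]
    split_ifs with hp hp'
    · exact h1 p hp
    · rw [hp', h2]
    · rw [Nat.add_sub_cancel' (by lia)]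

theorem leadingTrues_markerCons (i : ℕ) (z : ℕ → Bool) {p : ℕ} (hp : i < p) :
    leadingTrues (markerCons i z) p = i :=
  leadingTrues_eq_of_lt (fun k hk => if_pos hk) (by simp [markerCons]) hp

theorem markerCons_mem_cylinder_iff {i l : ℕ} {z z' : ℕ → Bool} :
    markerCons i z' ∈ cylinder (markerCons i z) (i + 1 + l) ↔ z' ∈ cylinder z l := by
  constructor
  · intro h s hs
    simpa only [markerCons_marker_add] using h (i + 1 + s) (by lia)
  · intro h p hp
    rw [markerCons, markerCons]
    split_ifs
    · rfl
    · rfl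
    · exact h _ (by lia)

section CounterUnion

variable {m a : ℕ → ℕ} {ok : ℕ → ℕ → Bool}

theorem counterUnion_const_true : counterUnion m a ok (fun _ => true) = fun _ => true := by
  funext p
  rw [counterUnion, if_pos (leadingTrues_eq_self_iff.2 fun _ _ => rfl)]

theorem counterUnion_markerCons (i : ℕ) (z : ℕ → Bool) :
    counterUnion m a ok (markerCons i z) =
      markerCons i (counterSkew (m i) (truncatedShift (a i) (ok i)) z) := by
  funext p
  by_cases hp : p ≤ i
  · have : leadingTrues (markerCons i z) p = p :=
      leadingTrues_eq_self_iff.2 fun k hk => if_pos (by lia)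
    rw [counterUnion, if_pos this, markerCons, markerCons]
    split_ifs <;> first | rfl | lia
  · have := leadingTrues_markerCons i z (not_le.1 hp)
    rw [counterUnion, this, if_neg (by lia), markerCons, if_neg (by lia), if_neg (by lia)]
    simp only [markerCons_marker_add]

theorem iterate_counterUnion_const_true (j : ℕ) :
    (counterUnion m a ok)^[j] (fun _ => true) = fun _ => true :=
  iterate_fixed counterUnion_const_true j

theorem iterate_counterUnion_markerCons (i j : ℕ) (z : ℕ → Bool) :
    (counterUnion m a ok)^[j] (markerCons i z) =
      markerCons i ((counterSkew (m i) (truncatedShift (a i) (ok i)))^[j] z) :=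
  ((show Semiconj (markerCons i) (counterSkew (m i) (truncatedShift (a i) (ok i)))
    (counterUnion m a ok) from fun z => (counterUnion_markerCons i z).symm).iterate_right j z).symm

theorem counterUnion_surjective : Surjective (counterUnion m a ok) := by
  intro y
  rcases eq_const_true_or_exists_markerCons y with rfl | ⟨i, w, rfl⟩
  · exact ⟨_, counterUnion_const_true⟩
  · obtain ⟨z, rfl⟩ := counterSkew_surjective (m := m i) (truncatedShift_injective (a i) (ok i)) w
    exact ⟨_, counterUnion_markerCons i z⟩

/-- A truncated shift never moves an index up by more than `a`, whatever its tests say; this gives a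
computable modulus of continuity. -/
theorem counterUnion_congr {x y : ℕ → Bool} {p : ℕ}
    (h : ∀ s ≤ p + a (leadingTrues x p), x s = y s) :
    counterUnion m a ok x p = counterUnion m a ok y p := by
  have hl : leadingTrues y p = leadingTrues x p := leadingTrues_congr fun k hk => (h k (by lia)).symm
  have hle := leadingTrues_le x p
  rw [counterUnion, counterUnion, hl]
  split_ifs with hp
  · exact h p (by lia)
  · refine counterSkew_congr (fun s hs => h _ (by lia)) fun hm => h _ ?_
    have := truncatedShift_le (a (leadingTrues x p)) (ok (leadingTrues x p))
      (p - (leadingTrues x p + 1) - m (leadingTrues x p))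
    lia

/-! ### Computability -/

section Computability

variable {α : Type*} [Primcodable α]

theorem computable_counterSkew {M A P : α → ℕ} {O Z : α → ℕ → Bool} (hM : Computable M)
    (hA : Computable A) (hP : Computable P) (hO : Computable₂ O) (hZ : Computable₂ Z) :
    Computable fun x => counterSkew (M x) (truncatedShift (A x) (O x)) (Z x) (P x) := by
  have hφ : Computable fun x => truncatedShift (A x) (O x) (P x - M x) := by
    have hn := hP.nat_sub hM
    have hl := computable_leadingTrues hO (Computable.succ.comp hn)
    exact Computable.ite_of_decide (Computable.decide_eq hl (Computable.succ.comp hn))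
      (hn.nat_add hA) (Computable.ite_of_decide (Computable.decide_lt hn (hl.nat_add hA))
        (hn.nat_sub hl) hn)
  refine Computable.ite_of_decide (Computable.decide_lt hP hM) ?_
    (Computable.ite_of_decide (Computable.decide_eq (computable_leadingTrues hZ hM) hM)
      (hZ.comp Computable.id (hM.nat_add hφ)) (hZ.comp Computable.id hP))
  exact (Primrec.dom_finite fun b : Bool × Bool => b.1 ^^ b.2).to_comp.comp
    ((hZ.comp Computable.id hP).pair (Computable.decide_eq (computable_leadingTrues hZ hP) hP))

theorem computable_counterUnion (hm : Computable m) (ha : Computable a) (hok : Computable₂ ok)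
    {X : α → ℕ → Bool} {P : α → ℕ} (hX : Computable₂ X) (hP : Computable P) :
    Computable fun x => counterUnion m a ok (X x) (P x) := by
  have hl := computable_leadingTrues hX hP
  refine Computable.ite_of_decide (Computable.decide_eq hl hP) (hX.comp Computable.id hP) ?_
  refine computable_counterSkew (hm.comp hl) (ha.comp hl)
    (hP.nat_sub (Computable.succ.comp hl)) ?_ ?_
  · exact hok.comp (hl.comp Computable.fst) Computable.snd
  · exact hX.comp Computable.fst
      ((Computable.succ.comp (hl.comp Computable.fst)).nat_add Computable.snd)

end Computability

theorem mem_binaryCylinder_iff_getD {x : ℕ → Bool} {w : List Bool} :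
    x ∈ binaryCylinder w ↔ ∀ i < w.length, x i = w.getD i false :=
  forall₂_congr fun i hi => by rw [List.getD_eq_getElem _ _ hi]

/-- The enumerated set is even decidable: it consists of the `u` long enough for the modulus of
`counterUnion_congr` and forcing the output `v`. -/
theorem isComputableCantorMap_counterUnion (hm : Computable m) (ha : Computable a)
    (hok : Computable₂ ok) : IsComputableCantorMap (counterUnion m a ok) := by
  -- The length condition ensures that the padding of `u` by `false` does not affect the output bit.
  -- Bits are compared through `Bool.toNat` in order to use `Computable.decide_eq`.
  let test : List Bool × List Bool → ℕ → Bool := fun x p =>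
    decide (p + a (leadingTrues (fun s => x.2.getD s false) p) < x.2.length) &&
      decide ((counterUnion m a ok (fun s => x.2.getD s false) p).toNat = (x.1.getD p false).toNat)
  have hget : Computable₂ fun (w : List Bool) (s : ℕ) => w.getD s false :=
    (Primrec.list_getD false).to_comp
  have hu : Computable fun x : (List Bool × List Bool) × ℕ => x.1.2 :=
    Computable.snd.comp Computable.fst
  have hX : Computable₂ fun (x : (List Bool × List Bool) × ℕ) (s : ℕ) => x.1.2.getD s false :=
    hget.comp (hu.comp Computable.fst) Computable.snd
  have hnat : Computable Bool.toNat := (Primrec.dom_finite _).to_comp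
  have htest : Computable₂ test := by
    refine Computable.bool_and (Computable.decide_lt ?_ (Computable.list_length.comp hu))
      (Computable.decide_eq (hnat.comp ?_) (hnat.comp ?_))
    · exact Computable.snd.nat_add (ha.comp (computable_leadingTrues hX Computable.snd))
    · exact computable_counterUnion hm ha hok hX Computable.snd
    · exact hget.comp (Computable.fst.comp Computable.fst) Computable.snd
  refine ⟨fun v u => leadingTrues (test (v, u)) v.length = v.length, ?_, fun v => ?_⟩
  · refine ComputablePred.to_re (Computable.computablePred ?_)
    have hlen : Computable fun x : List Bool × List Bool => x.1.length :=
      Computable.list_length.comp Computable.fst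
    exact Computable.decide_eq (computable_leadingTrues htest hlen) hlen
  · have hR : ∀ u, leadingTrues (test (v, u)) v.length = v.length ↔ ∀ p < v.length,
        p + a (leadingTrues (fun s => u.getD s false) p) < u.length ∧
          counterUnion m a ok (fun s => u.getD s false) p = v.getD p false := by
      intro u
      have htn : ∀ b c : Bool, b.toNat = c.toNat ↔ b = c := by decide
      rw [leadingTrues_eq_self_iff]
      refine forall₂_congr fun p _ => ?_
      simp only [test, Bool.and_eq_true, decide_eq_true_eq, htn]
    ext x
    simp only [Set.mem_preimage, Set.mem_iUnion, Set.mem_ofPred_eq, hR,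
      mem_binaryCylinder_iff_getD, exists_prop]
    constructor
    · intro h
      -- A sum exceeds each of its terms, so `N` bits of `x` suffice for every output bit below
      -- `v.length`.
      let N := ∑ p ∈ Finset.range v.length, (p + a (leadingTrues x p) + 1)
      have hN : ∀ p < v.length, p + a (leadingTrues x p) < N := fun p hp =>
        Finset.single_le_sum (f := fun p => p + a (leadingTrues x p) + 1) (fun _ _ => Nat.zero_le _)
          (Finset.mem_range.2 hp)
      have hxN : ∀ s < N, x s = (initialWord x N).getD s false := fun s hs => by
        rw [List.getD_eq_getElem _ _ (by simpa using hs), getElem_initialWord]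
      refine ⟨initialWord x N, fun p hp => ?_, by simpa using hxN⟩
      have hl : leadingTrues (fun s => (initialWord x N).getD s false) p = leadingTrues x p :=
        leadingTrues_congr fun k hk => (hxN k (by have := hN p hp; lia)).symm
      refine ⟨by rw [hl, length_initialWord]; exact hN p hp, ?_⟩
      rw [← h p hp]
      exact (counterUnion_congr fun s hs => hxN s (by have := hN p hp; lia)).symm
    · rintro ⟨u, hu, hx⟩ p hp
      rw [← (hu p hp).2]
      exact (counterUnion_congr fun s hs => (hx s (by have := (hu p hp).1; lia)).symm).symm

/-! ### Entropy -/

/-- The chosen precision shows the marker, the counter and the `a i` bits that the next overflow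
discards. The itinerary over `k + 1` times then determines the first `m i + l` bits of `z`, with `l
≥ a i * (k + 1) / 2 ^ m i`, so there are at least `2 ^ (m i + l)` itineraries. -/
theorem div_two_pow_le_entropyRelCover {i : ℕ} (hi : ∀ j, ok i j = true) :
    (a i : ℝ) / 2 ^ m i ≤
      entropyRelCover (counterUnion m a ok) (cylinderPartition (i + 1 + (m i + a i))) := by
  have hφ := truncatedShift_of_forall (a := a i) hi
  refine le_ciInf fun k => ?_
  let l := ⌈((a i * (k + 1) : ℕ) : ℝ) / 2 ^ m i⌉₊
  have hl : ((a i * (k + 1) : ℕ) : ℝ) / 2 ^ m i ≤ l := Nat.le_ceil _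
  have hN : 2 ^ (m i + l) ≤ minSubcoverCard (counterUnion m a ok)
      (cylinderPartition (i + 1 + (m i + a i))) (k + 1) := by
    refine le_trans (by simp) (card_le_minSubcoverCard
      (fun w : Fin (m i + l) → Bool => markerCons i (padFalse w)) fun v w h => ?_)
    simp only [iterate_counterUnion_markerCons, markerCons_mem_cylinder_iff] at h
    obtain ⟨l', h1, h2⟩ := exists_mem_cylinder_of_iterate_counterSkew hφ k fun j hj =>
      h j (Nat.lt_succ_of_le hj)
    have hll' : l ≤ l' := by
      refine Nat.ceil_le.2 ((div_le_iff₀ (by positivity)).2 ?_)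
      have : a i * (k + 1) ≤ l' * 2 ^ m i := by
        rw [mul_comm l']
        exact le_trans (Nat.le_add_right _ _) h2
      exact_mod_cast this
    funext r
    have := h1 r (by lia)
    simpa [padFalse] using this.symm
  have hN' : ((m i + l : ℕ) : ℝ) ≤ Real.logb 2 (minSubcoverCard (counterUnion m a ok)
      (cylinderPartition (i + 1 + (m i + a i))) (k + 1) : ℝ) := by
    rw [Real.le_logb_iff_rpow_le (by norm_num)
      (by exact_mod_cast lt_of_lt_of_le (by positivity) hN), Real.rpow_natCast]
    exact_mod_cast hN
  rw [le_div_iff₀ (by positivity)]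
  calc (a i : ℝ) / 2 ^ m i * ((k : ℝ) + 1) = ((a i * (k + 1) : ℕ) : ℝ) / 2 ^ m i := by
        push_cast; ring
    _ ≤ l := hl
    _ ≤ ((m i + l : ℕ) : ℝ) := by push_cast; simp
    _ ≤ _ := hN'

/-- If `s` bounds the speed of the translation, an initial segment of length `C + s k` determines
the itinerary up to time `k`. -/
theorem exists_iterate_counterSkew_modulus {M A : ℕ} {O : ℕ → Bool} {s : ℝ}
    (hs : (∀ j, O j = true) → (A : ℝ) / 2 ^ M ≤ s) (n : ℕ) :
    ∃ C, ∀ k : ℕ, ∀ z, ∀ z' ∈ cylinder z (C + ⌈s * k⌉₊), ∀ j < k,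
      (counterSkew M (truncatedShift A O))^[j] z' ∈
        cylinder ((counterSkew M (truncatedShift A O))^[j] z) n := by
  by_cases hO : ∀ j, O j = true
  · refine ⟨M + (n + A), fun k z z' h j hj => ?_⟩
    rw [add_assoc M] at h
    refine iterate_counterSkew_mem_cylinder (truncatedShift_of_forall hO) h ?_
    have h1 : ((A * k : ℕ) : ℝ) ≤ ((2 ^ M * ⌈s * k⌉₊ : ℕ) : ℝ) := by
      push_cast
      calc (A : ℝ) * k ≤ (s * 2 ^ M) * k := by
            gcongr
            exact (div_le_iff₀ (by positivity)).1 (hs hO)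
        _ = 2 ^ M * (s * k) := by ring
        _ ≤ _ := by gcongr; exact Nat.le_ceil _
    have h2 : A * k ≤ 2 ^ M * ⌈s * k⌉₊ := by exact_mod_cast h1
    have h3 : A * j ≤ A * k := Nat.mul_le_mul_left A hj.le
    rw [mul_add, mul_add]
    lia
  · obtain ⟨T, h1, h2⟩ := exists_first_false hO
    -- The truncated shift preserves every initial segment of length at least `T + A`.
    refine ⟨M + (n + T + A), fun k z z' h j _ => ?_⟩
    refine cylinder_anti _ (by lia) (iterate_counterSkew_mem_cylinder_of_lt ?_
      (cylinder_anti z (Nat.le_add_right _ _) h) j)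
    intro r hr
    rw [truncatedShift_of_first h1 h2]
    split_ifs <;> lia

/-- A point starting with `n` trues keeps them forever, so at precision `n` only the pieces `i < n`
matter, and the constant can absorb theirs by a finite sum. -/
theorem exists_iterate_counterUnion_modulus {s : ℝ}
    (hs : ∀ i, (∀ j, ok i j = true) → (a i : ℝ) / 2 ^ m i ≤ s) (n : ℕ) :
    ∃ C, ∀ k : ℕ, ∀ x, ∀ y ∈ cylinder x (C + ⌈s * k⌉₊), ∀ j < k,
      (counterUnion m a ok)^[j] y ∈ cylinder ((counterUnion m a ok)^[j] x) n := by
  choose C hC using fun i => exists_iterate_counterSkew_modulus (hs i) n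
  have hsum : ∀ i < n, i + 1 + C i ≤ ∑ i ∈ Finset.range n, (i + 1 + C i) := fun i hi =>
    Finset.single_le_sum (f := fun i => i + 1 + C i) (fun _ _ => Nat.zero_le _)
      (Finset.mem_range.2 hi)
  have hinit : ∀ x, (∀ p < n, x p = true) → ∀ j, ∀ p < n,
      (counterUnion m a ok)^[j] x p = true := by
    intro x hx j p hp
    rcases eq_const_true_or_exists_markerCons x with rfl | ⟨i, z, rfl⟩
    · rw [iterate_counterUnion_const_true]
    · have hi : n ≤ i := by
        by_contra hi
        have := hx i (by lia)
        simp [markerCons] at this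
      rw [iterate_counterUnion_markerCons]
      exact if_pos (by lia)
  refine ⟨n + ∑ i ∈ Finset.range n, (i + 1 + C i), fun k x y hxy j hj => ?_⟩
  by_cases hx : ∀ p < n, x p = true
  · have hy : ∀ p < n, y p = true := fun p hp => (hxy p (by lia)).trans (hx p hp)
    exact fun p hp => (hinit y hy j p hp).trans (hinit x hx j p hp).symm
  · obtain ⟨p, hp, hpx⟩ : ∃ p < n, x p = false := by simpa using hx
    rcases eq_const_true_or_exists_markerCons x with rfl | ⟨i, z, rfl⟩
    · cases hpx
    have hip : i ≤ p := by
      by_contra hip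
      rw [markerCons, if_pos (by lia)] at hpx
      cases hpx
    have hyz : y = markerCons i fun s => y (i + 1 + s) := by
      funext q
      by_cases hq : q ≤ i
      · rw [hxy q (by lia), markerCons, markerCons]
        split_ifs <;> first | rfl | lia
      · rw [markerCons, if_neg (by lia), if_neg (by lia), Nat.add_sub_cancel' (by lia)]
    rw [hyz] at hxy ⊢
    rw [iterate_counterUnion_markerCons, iterate_counterUnion_markerCons]
    have hle := hsum i (by lia)
    have h1 := markerCons_mem_cylinder_iff.1 (cylinder_anti (m := i + 1 + (C i + ⌈s * k⌉₊)) _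
      (by lia) hxy)
    exact cylinder_anti _ (by lia) (markerCons_mem_cylinder_iff.2 (hC i k z _ h1 j hj))

theorem entropyRelCover_counterUnion_le {s : ℝ} (hs0 : 0 ≤ s)
    (hs : ∀ i, (∀ j, ok i j = true) → (a i : ℝ) / 2 ^ m i ≤ s) (n : ℕ) :
    entropyRelCover (counterUnion m a ok) (cylinderPartition n) ≤ s := by
  obtain ⟨C, hC⟩ := exists_iterate_counterUnion_modulus hs n
  refine le_of_forall_pos_le_add fun ε hε => ?_
  -- The quotient is at most `s + (C + 1) / (k + 1)`, where the extra 1 comes from the ceiling.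
  obtain ⟨k, hk⟩ := exists_nat_gt (((C : ℝ) + 1) / ε)
  have hN := minSubcoverCard_le_two_pow (refines_cylinderPartition n) (hC (k + 1))
  have hN0 : 0 < minSubcoverCard (counterUnion m a ok) (cylinderPartition n) (k + 1) :=
    minSubcoverCard_pos (finite_cylinderPartition n) (sUnion_cylinderPartition n) _
  refine (entropyRelCover_le k).trans ((div_le_iff₀ (by positivity)).2 ?_)
  have hlog : Real.logb 2 (minSubcoverCard (counterUnion m a ok) (cylinderPartition n) (k + 1) : ℝ)
      ≤ ((C + ⌈s * (k + 1 : ℕ)⌉₊ : ℕ) : ℝ) := by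
    rw [Real.logb_le_iff_le_rpow (by norm_num) (by positivity), Real.rpow_natCast]
    exact_mod_cast hN
  have hceil := Nat.ceil_lt_add_one (mul_nonneg hs0 (Nat.cast_nonneg (α := ℝ) (k + 1)))
  rw [div_lt_iff₀ hε] at hk
  push_cast at hlog hceil
  nlinarith

end CounterUnion

/-! ### Realizing a Σ₂ number -/

theorem exists_dyadic_btwn {r y : ℝ} (hr : 0 ≤ r) (hry : r < y) :
    ∃ a m : ℕ, r < ((a + 1 : ℕ) : ℝ) / 2 ^ m ∧ ((a + 1 : ℕ) : ℝ) / 2 ^ m ≤ y := by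
  obtain ⟨m, hm⟩ := exists_pow_lt_of_lt_one (sub_pos.2 hry) (one_half_lt_one (α := ℝ))
  have h2 : (0 : ℝ) < 2 ^ m := by positivity
  rw [one_div, inv_pow, inv_lt_iff_one_lt_mul₀ h2] at hm
  -- The least multiple of `2 ^ (-m)` above `r` exceeds it by at most `2 ^ (-m) < y - r`.
  refine ⟨⌊r * 2 ^ m⌋₊, m, ?_, ?_⟩
  · rw [lt_div_iff₀ h2]
    push_cast
    exact Nat.lt_floor_add_one _
  · rw [div_le_iff₀ h2]
    push_cast
    have := Nat.floor_le (mul_nonneg hr h2.le)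
    nlinarith

theorem exists_computable_surjective_topologicalEntropy_eq {h : ℝ} (h_nonneg : 0 ≤ h)
    (hh : IsSigmaTwoComputable h) : ∃ f : (ℕ → Bool) → (ℕ → Bool),
      IsComputableCantorMap f ∧ Surjective f ∧ topologicalEntropy f = (h : EReal) := by
  obtain ⟨q, ⟨num, den, hnum, hden, hq⟩, y, hy, hlub⟩ := hh
  -- The code `i` stands for `(s, b, m)` with `a = b + 1`. Positivity of `a` makes the test `ok`
  -- fail when the rational is negative, although `Int.toNat` then replaces its numerator by 0.
  let a : ℕ → ℕ := fun i => i.unpair.2.unpair.1 + 1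
  let m : ℕ → ℕ := fun i => i.unpair.2.unpair.2
  let ok : ℕ → ℕ → Bool := fun i j =>
    decide (a i * den i.unpair.1 j < 2 ^ m i * (num i.unpair.1 j).toNat + 1)
  have hu2 : Primrec fun i : ℕ => i.unpair.2 := Primrec.snd.comp Primrec.unpair
  have ha : Primrec a := Primrec.succ.comp (Primrec.fst.comp (Primrec.unpair.comp hu2))
  have hm : Primrec m := Primrec.snd.comp (Primrec.unpair.comp hu2)
  have hok : Computable₂ ok := by
    have hs : Computable fun x : ℕ × ℕ => x.1.unpair.1 :=
      Computable.fst.comp (Computable.unpair.comp Computable.fst)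
    refine Computable.decide_lt ?_ (Computable.succ.comp ?_)
    · exact Primrec.nat_mul.to_comp.comp (ha.to_comp.comp Computable.fst)
        (hden.comp hs Computable.snd)
    · exact Primrec.nat_mul.to_comp.comp
        ((Primrec.nat_pow.comp (Primrec.const 2) hm).to_comp.comp Computable.fst)
        (primrec_intToNat.to_comp.comp (hnum.comp hs Computable.snd))
  have hok_iff : ∀ i, (∀ j, ok i j = true) ↔ (a i : ℝ) / 2 ^ m i ≤ y i.unpair.1 := by
    intro i
    rw [le_isGLB_iff (hy _), mem_lowerBounds, Set.forall_mem_range]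
    refine forall_congr' fun j => ?_
    obtain ⟨hd, hqd⟩ := hq i.unpair.1 j
    have hd0 : (0 : ℝ) < den i.unpair.1 j := by exact_mod_cast Nat.pos_of_ne_zero hd
    rw [hqd]
    push_cast
    rw [div_le_div_iff₀ (by positivity) hd0, decide_eq_true_eq, Nat.lt_succ_iff]
    have hpos : 0 < a i * den i.unpair.1 j := Nat.mul_pos (Nat.succ_pos _) (Nat.pos_of_ne_zero hd)
    rw [mul_comm (2 ^ m i)]
    obtain hz | hz := le_or_gt 0 (num i.unpair.1 j)
    · obtain ⟨z, hz⟩ := Int.eq_ofNat_of_zero_le hz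
      rw [hz, Int.toNat_natCast]
      exact_mod_cast Iff.rfl
    · rw [Int.toNat_of_nonpos hz.le]
      refine iff_of_false (by lia) (not_le.2 ?_)
      have h1 : (num i.unpair.1 j : ℝ) < 0 := by exact_mod_cast hz
      have h2 : (0 : ℝ) < a i * den i.unpair.1 j := by exact_mod_cast hpos
      exact (mul_neg_of_neg_of_pos h1 (by positivity)).trans h2
  refine ⟨counterUnion m a ok, isComputableCantorMap_counterUnion hm.to_comp ha.to_comp hok,
    counterUnion_surjective, ?_⟩
  rw [topologicalEntropy_eq_iSup_cylinderPartition]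
  refine le_antisymm (iSup_le fun n => ?_) (le_of_not_gt fun hlt => ?_)
  · exact_mod_cast entropyRelCover_counterUnion_le h_nonneg
      (fun i hi => ((hok_iff i).1 hi).trans (hlub.1 ⟨_, rfl⟩)) n
  · obtain ⟨r, hr, hrh⟩ := EReal.lt_iff_exists_real_btwn.1 hlt
    have hr' : ∀ n, entropyRelCover (counterUnion m a ok) (cylinderPartition n) < r := fun n => by
      exact_mod_cast (le_iSup (fun n => (entropyRelCover (counterUnion m a ok)
        (cylinderPartition n) : EReal)) n).trans_lt hr
    obtain ⟨_, ⟨s, rfl⟩, hs⟩ := (lt_isLUB_iff hlub).1 (EReal.coe_lt_coe_iff.1 hrh)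
    -- Here `0 ≤ r` because `r` exceeds a relative entropy. A dyadic strictly above `r` and at most
    -- `y s` survives all tests, so its piece alone forces an entropy above `r`.
    obtain ⟨b, e, h1, h2⟩ := exists_dyadic_btwn (entropyRelCover_nonneg.trans (hr' 0).le) hs
    have hi := div_two_pow_le_entropyRelCover (m := m) (a := a) (ok := ok)
      (i := Nat.pair s (Nat.pair b e)) ((hok_iff _).2 (by simpa [a, m] using h2))
    refine absurd (hi.trans_lt (hr' _)) (not_lt.2 ?_)
    simpa [a, m] using h1.le

theorem theoremB (h : ℝ) (h_nonneg : 0 ≤ h) :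
    (∃ f : (ℕ → Bool) → (ℕ → Bool),
      IsComputableCantorMap f ∧ Function.Surjective f ∧ topologicalEntropy f = (h : EReal)) ↔
      IsSigmaTwoComputable h := by
  constructor
  · rintro ⟨f, hf, -, hh⟩
    exact isSigmaTwoComputable_of_topologicalEntropy_eq hf hh
  · exact exists_computable_surjective_topologicalEntropy_eq h_nonneg
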